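/- A $c$-regular two-way labeled graph $G$ on $n\ge 1$ vertices, $c\ge 1$, is an undirected multigraph (self-loops allowed) on $[n]$ given by its rotation map, an involution $\mathrm{Rot}_G$ of $[n]\times[c]$, where $\mathrm{Rot}_G(v,i)=(w,j)$ means that the $i$-th edge at $v$ leads to $w$ and is the $j$-th edge at $w$. Its transition matrix $T$ has entries $T_{uw}=\frac1c\,\#\{i\in[c]:\text{the } i\text{-th edge at } u \text{ leads to } w\}$, and $\lambda(G)=\max_{v\perp\vec 1,\,v\ne 0}\|Tv\|/\|v\|$ (Euclidean norm; $\lambda(G)=0$ if $n=1$). A family $\{G_{n,c}\}_{(n,c)\in I}$, $I\subseteq\mathbb N_{>0}^2$, with $G_{n,c}$ a $c$-regular two-way labeled graph on $n$ vertices, is a family of expanders if $\sup_{(n,c)\in I}\lambda(G_{n,c})<1$, and it is strongly explicit if a single deterministic Turing machine with a read-only input tape, a constant number of read/write work tapes and a write-only output tape, given $n,c$ with $(n,c)\in I$, $v\in[n]$ and $a\in[c]$ in binary, computes $\mathrm{Rot}_{G_{n,c}}(v,a)$ in time $\mathrm{poly}(\log(nc))$ and, simultaneously, using $O(\log(nc))$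 work tape cells (up to an additive constant). Theorem. There is a strongly explicit family of expanders $\mathcal H=\{H_{n,c}\}$ such that for every $\lambda\in(0,1)$ there is a degree $c=c(\lambda)$, bounded by a fixed polynomial in $1/\lambda$ and not depending on $n$, such that for every integer $n>1$ the family $\mathcal H$ contains a $c$-regular graph $H_{n,c}$ on exactly $n$ vertices, and $\lambda(H_{n,c})\le\lambda$. -/

import Mathlib

/-! ### Regular multigraphs with a two-way labeling, given by their rotation maps -/

/-- A `c`-regular undirected multigraph on the vertex set `[n]` with a two-way labeling.
`rot (v, i) = (w, j)` says that the `i`-th edge at `v` leads to `w` and is the `j`-th edge at `w`;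
the orbits of the involution `rot` are the edges.  A self-loop may carry one label
(a fixed point of `rot`) or two labels at its vertex. -/
structure LabeledGraph (n c : ℕ) where
  rot : Fin n × Fin c → Fin n × Fin c
  rot_involutive : Function.Involutive rot

namespace LabeledGraph

variable {n c : ℕ}

/-- The adjacency matrix: the number of edge labels at `u` whose edge leads to `w`. -/
def adj (G : LabeledGraph n c) : Matrix (Fin n) (Fin n) ℝ :=
  Matrix.of fun u w => ((Finset.univ.filter fun i : Fin c => (G.rot (u, i)).1 = w).card : ℝ)

/-- The transition matrix of the random walk. -/
noncomputable def transition (G : LabeledGraph n c) : Matrix (Fin n) (Fin n) ℝ :=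
  (c : ℝ)⁻¹ • G.adj

/-- `λ(G)`: the supremum of `‖T v‖ / ‖v‖` over the nonzero vectors `v` orthogonal to the
all-ones vector, where `T` is the transition matrix and `‖·‖` is the Euclidean norm. -/
noncomputable def lam (G : LabeledGraph n c) : ℝ :=
  sSup {r : ℝ | ∃ v : EuclideanSpace ℝ (Fin n), v ≠ 0 ∧ ∑ i, v i = 0 ∧
    r = ‖(WithLp.toLp 2 (G.transition.mulVec v.ofLp) : EuclideanSpace ℝ (Fin n))‖ / ‖v‖}

end LabeledGraph

/-- A family `{G_{n,c}}` of two-way labeled graphs, indexed by a set of pairs `(n, c)` of positive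
integers, where `G_{n,c}` is `c`-regular on `n` vertices. -/
structure GraphFamily where
  index : Set (ℕ × ℕ)
  pos : ∀ n c, (n, c) ∈ index → 0 < n ∧ 0 < c
  graph : ∀ n c, (n, c) ∈ index → LabeledGraph n c

/-- A family of expanders: `λ` is bounded away from `1` on the members of the family. -/
def GraphFamily.IsExpander (H : GraphFamily) : Prop :=
  ∃ μ : ℝ, μ < 1 ∧ ∀ (n c : ℕ) (h : (n, c) ∈ H.index), (H.graph n c h).lam ≤ μ

/-! ### Space-bounded Turing machines -/

/-- The symbols on the input and output tapes. -/
inductive IOSym where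
  | bit (b : Bool)
  | sep

/-- Movements of a tape head. -/
inductive HeadMove where
  | left
  | stay
  | right

/-- What a machine with `k` work tapes does in one step: new state, movement of the input head,
symbol written on each work tape, movement of each work head, and at most one symbol appended to
the output. -/
structure MachineAction (State Alphabet : Type) (k : ℕ) where
  next : State
  inMove : HeadMove
  write : Fin k → Alphabet
  move : Fin k → HeadMove
  emit : Option IOSym

/-- A deterministic Turing machine with a two-way read-only input tape, finitely many one-way
infinite read/write work tapes and a write-only output tape.  The value `none` of the transition
function means that the machine halts. -/
structure OfflineTM where
  State : Type
  Alphabet : Type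
  tapes : ℕ
  state_finite : Finite State
  alphabet_finite : Finite Alphabet
  blank : Alphabet
  start : State
  trans : State → Option IOSym → (Fin tapes → Alphabet) →
    Option (MachineAction State Alphabet tapes)

namespace OfflineTM

/-- Configurations; `out` is the word written so far on the output tape. -/
structure Config (M : OfflineTM) where
  state : M.State
  inHead : ℕ
  work : Fin M.tapes → ℕ → M.Alphabet
  head : Fin M.tapes → ℕ
  out : List IOSym

/-- The head position after a move on a one-way infinite tape whose leftmost cell is `0`. -/
def moveHead (p : ℕ) : HeadMove → ℕ
  | .left => p - 1
  | .stay => p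
  | .right => p + 1

variable (M : OfflineTM)

/-- The initial configuration. -/
def init : M.Config where
  state := M.start
  inHead := 0
  work := fun _ _ => M.blank
  head := fun _ => 0
  out := []

/-- One step on input `x`; `none` if the machine has halted.  The input head moves on the cells of
the input and on the one blank cell that follows them (read as `none`). -/
def step (x : List IOSym) (C : M.Config) : Option M.Config :=
  (M.trans C.state x[C.inHead]? (fun i => C.work i (C.head i))).map fun a =>
    { state := a.next
      inHead := min (moveHead C.inHead a.inMove) x.length
      work := fun i => Function.update (C.work i) (C.head i) (a.write i)
      head := fun i => moveHead (C.head i) (a.move i)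
      out := C.out ++ a.emit.toList }

/-- The configuration after `t` steps on input `x` (a halting configuration is kept). -/
def run (x : List IOSym) : ℕ → M.Config
  | 0 => M.init
  | t + 1 => (M.step x (run x t)).getD (run x t)

/-- The total number of work tape cells visited during the first `t` steps on input `x`. -/
def space (x : List IOSym) (t : ℕ) : ℕ :=
  ∑ i : Fin M.tapes, ((Finset.range (t + 1)).image fun s => (M.run x s).head i).card

/-- On input `x` the machine halts with output `y` after at most `T` steps, having used at most
`S` work tape cells. -/
def ComputesWithin (x y : List IOSym) (T S : ℕ) : Prop :=
  ∃ t ≤ T, M.step x (M.run x t) = none ∧ (M.run x t).out = y ∧ M.space x t ≤ S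

end OfflineTM

/-- A list of natural numbers as a word: each number in binary, followed by a separator. -/
def encodeNats (l : List ℕ) : List IOSym :=
  l.flatMap fun k => (Nat.bits k).map IOSym.bit ++ [IOSym.sep]

/-- Strong explicitness: one machine that, given `n`, `c`, a vertex `v` and an edge label `a` in
binary, computes the rotation map of the member `G_{n,c}` of the family at `(v, a)` in time
`poly(log (nc))` and space `O(log (nc))`. -/
def GraphFamily.StronglyExplicit (H : GraphFamily) : Prop :=
  ∃ (M : OfflineTM) (p : Polynomial ℕ) (A : ℕ),
    ∀ (n c : ℕ) (h : (n, c) ∈ H.index) (v : Fin n) (a : Fin c),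
      M.ComputesWithin
        (encodeNats [n, c, v, a])
        (encodeNats [((H.graph n c h).rot (v, a)).1, ((H.graph n c h).rot (v, a)).2])
        (p.eval (Nat.log 2 (n * c)))
        (A * (Nat.log 2 (n * c) + 1))

/-! A lazy graph of degree 64 on any number `n` of vertices, with a spectral gap independent of `n`,
is obtained by folding a Gabber–Galil expander. The family consists of the graphs of its walks of
length `t ≥ 1`, which have degree `64 ^ t`.

On the torus `(ℤ/m)²` take the shears of each coordinate by twice the other one, plus `0` or `1`. On
the Fourier side a shear becomes the dual shear times a phase, and the two phases of each pair add
up to a multiplier of modulus `2 cos(π|a|/m)`. A weighted AM–GM inequality, with weight 4/5 towards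
a frequency farther from `0` and 5/4 towards a nearer one, bounds the correlation
(`sum_amp_mul_le`). Near the origin at most one of the four neighbours is nearer; away from it the
multipliers are small. This gives the Poincaré inequality `GabberGalil.sum_sq_le_dirichlet` with
constant 7/10.

For general `n`, take the torus with `4 ^ K` points, `n < 4 ^ K ≤ 4 n`, number its points by
interleaving the bits of the coordinates, and reduce the numbers modulo `n`. Each vertex has at most
four preimages `v + j n`, and the label contains `j`. A function of mean zero on the vertices lifts
to the torus, where subtracting the mean costs nothing, so the gap survives the folding
(`sum_sq_le_sum_hop`). Half of the labels do not move; this laziness turns the Dirichlet bound into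
a bound on the norm of the walk operator, negative eigenvalues included (`sum_hopAvg_sq_le`). Walks
of length `t` raise this bound to the power `t` (`walkGraph_lam_le`). The least sufficient `t` is
logarithmic in `1 / λ`, so the degree is polynomial (`exists_degree`).

For explicitness, the digits of all numbers lie in parallel tracks of a single tape of `O(log (n
c))` cells. Interleaving makes a shear a digit-local operation with a bounded carry, and the
reduction modulo `n` is a choice among the four differences `Y - j n`. Hence one sweep to the right
and one to the left perform a step of the walk (`reach_round`), and the whole run takes quadratic
time in the logarithm (`computesWithin_walk`). -/

/-! ### The Gabber–Galil bound on `(ℤ/m)²` -/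

namespace GabberGalil

open ZMod Finset

variable {m : ℕ}

/-- The distance of a residue to `0`. -/
def dist0 (a : ZMod m) : ℕ := a.valMinAbs.natAbs

lemma two_mul_dist0_le [NeZero m] (a : ZMod m) : 2 * dist0 a ≤ m := by
  have := natAbs_valMinAbs_le a
  unfold dist0; omega

lemma dist0_neg (a : ZMod m) : dist0 (-a) = dist0 a := natAbs_valMinAbs_neg a

lemma dist0_natCast [NeZero m] {t : ℕ} (ht : t < m) : dist0 (t : ZMod m) = min t (m - t) := by
  rw [dist0, valMinAbs_natAbs_eq_min, val_cast_of_lt ht]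

lemma dist0_intCast [NeZero m] {t : ℤ} (ht : t.natAbs < m) :
    dist0 (t : ZMod m) = min t.natAbs (m - t.natAbs) := by
  rw [← dist0_natCast ht]
  rcases Int.natAbs_eq t with h | h
  · conv_lhs => rw [h, Int.cast_natCast]
  · conv_lhs => rw [h, Int.cast_neg, Int.cast_natCast, dist0_neg]

/-! ### Weighted AM–GM along the orbits of the shears. -/

/-- The weight given to a point at height `p` in the estimate of its product with a neighbour at
height `q`. -/
noncomputable def wt (p q : ℕ) : ℝ := if p < q then 4 / 5 else if q < p then 5 / 4 else 1

lemma wt_of_lt {p q : ℕ} (h : p < q) : wt p q = 4 / 5 := by simp [wt, h]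
lemma wt_of_gt {p q : ℕ} (h : q < p) : wt p q = 5 / 4 := by simp [wt, h, h.le]
lemma wt_of_eq {p q : ℕ} (h : q = p) : wt p q = 1 := by simp [wt, h]

lemma wt_le (p q : ℕ) : wt p q ≤ 5 / 4 := by
  unfold wt; split_ifs <;> norm_num

lemma wt_nonneg (p q : ℕ) : 0 ≤ wt p q := by
  unfold wt; split_ifs <;> norm_num

/-- The two weights of a pair are reciprocal, so this is AM–GM. -/
lemma two_mul_le_wt (p q : ℕ) (x y : ℝ) : 2 * (x * y) ≤ wt p q * x ^ 2 + wt q p * y ^ 2 := by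
  rcases lt_trichotomy p q with h | h | h
  · rw [wt_of_lt h, wt_of_gt h]; nlinarith [sq_nonneg (4 * x - 5 * y)]
  · rw [wt_of_eq h, wt_of_eq h.symm]; nlinarith [sq_nonneg (x - y)]
  · rw [wt_of_lt h, wt_of_gt h]; nlinarith [sq_nonneg (5 * x - 4 * y)]

/-- If `p < q`, both shears of the smaller coordinate raise it, one shear of the larger one raises
it and the other lowers it: the sum is `3 · 4/5 + 5/4 = 73/20`. If the coordinates are equal, or one
of them is `0`, two weights are 1 and two are 4/5, which gives less. The hypothesis on `2 * (p + q)`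
keeps a raised coordinate raised after reduction modulo `m`. -/
lemma sum_wt_min_le {m p q : ℕ} (h : 2 * (p + q) < m) (h0 : p ≠ 0 ∨ q ≠ 0) :
    wt q (min (q + 2 * p) (m - (q + 2 * p))) +
      wt q (min ((q - 2 * p) + (2 * p - q)) (m - ((q - 2 * p) + (2 * p - q)))) +
      (wt p (min (p + 2 * q) (m - (p + 2 * q))) +
        wt p (min ((p - 2 * q) + (2 * q - p)) (m - ((p - 2 * q) + (2 * q - p))))) ≤ 73 / 20 := by
  obtain ⟨u, hu⟩ : ∃ u, u = min (q + 2 * p) (m - (q + 2 * p)) := ⟨_, rfl⟩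
  obtain ⟨w, hw⟩ : ∃ w, w = min (p + 2 * q) (m - (p + 2 * q)) := ⟨_, rfl⟩
  obtain ⟨u', hu'⟩ : ∃ u', u' = min ((q - 2 * p) + (2 * p - q))
    (m - ((q - 2 * p) + (2 * p - q))) := ⟨_, rfl⟩
  obtain ⟨w', hw'⟩ : ∃ w', w' = min ((p - 2 * q) + (2 * q - p))
    (m - ((p - 2 * q) + (2 * q - p))) := ⟨_, rfl⟩
  rw [← hu, ← hu', ← hw, ← hw']
  rcases lt_trichotomy p q with hlt | heq | hgt
  · rw [wt_of_lt (show p < w by omega), wt_of_lt (show p < w' by omega)]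
    rcases Nat.eq_zero_or_pos p with h0 | h0
    · rw [wt_of_eq (show u = q by omega), wt_of_eq (show u' = q by omega)]; norm_num
    · rw [wt_of_lt (show q < u by omega), wt_of_gt (show u' < q by omega)]; norm_num
  · rw [wt_of_lt (show p < w by omega), wt_of_eq (show w' = p by omega),
      wt_of_lt (show q < u by omega), wt_of_eq (show u' = q by omega)]; norm_num
  · rw [wt_of_lt (show q < u by omega), wt_of_lt (show q < u' by omega)]
    rcases Nat.eq_zero_or_pos q with h0 | h0
    · rw [wt_of_eq (show w = p by omega), wt_of_eq (show w' = p by omega)]; norm_num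
    · rw [wt_of_lt (show p < w by omega), wt_of_gt (show w' < p by omega)]; norm_num

lemma natAbs_sub_add_two_mul (A B : ℤ) :
    ((B - 2 * A).natAbs = B.natAbs + 2 * A.natAbs ∧
      (B + 2 * A).natAbs = (B.natAbs - 2 * A.natAbs) + (2 * A.natAbs - B.natAbs)) ∨
    ((B + 2 * A).natAbs = B.natAbs + 2 * A.natAbs ∧
      (B - 2 * A).natAbs = (B.natAbs - 2 * A.natAbs) + (2 * A.natAbs - B.natAbs)) := by
  rcases le_total 0 A with h1 | h1 <;> rcases le_total 0 B with h2 | h2 <;> omega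

/-- Which of `b ± 2a` is the outer neighbour depends on the signs of `a` and `b`. A symmetric
relation `R` does not see this, so no case distinction on signs is needed later. -/
lemma dist0_sub_add_two_mul [NeZero m] (a b : ZMod m) (h : 2 * (dist0 a + dist0 b) < m)
    (R : ℕ → ℕ → Prop) (hR : ∀ u v, R u v → R v u)
    (h' : R (min (dist0 b + 2 * dist0 a) (m - (dist0 b + 2 * dist0 a)))
      (min ((dist0 b - 2 * dist0 a) + (2 * dist0 a - dist0 b))
        (m - ((dist0 b - 2 * dist0 a) + (2 * dist0 a - dist0 b))))) :
    R (dist0 (b - 2 * a)) (dist0 (b + 2 * a)) := by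
  have e1 : b - 2 * a = ((b.valMinAbs - 2 * a.valMinAbs : ℤ) : ZMod m) := by
    simp
  have e2 : b + 2 * a = ((b.valMinAbs + 2 * a.valMinAbs : ℤ) : ZMod m) := by
    simp
  have hb : b.valMinAbs.natAbs = dist0 b := rfl
  have ha : a.valMinAbs.natAbs = dist0 a := rfl
  rw [e1, e2]
  rcases natAbs_sub_add_two_mul a.valMinAbs b.valMinAbs with ⟨h1, h2⟩ | ⟨h1, h2⟩ <;>
    rw [ha, hb] at h1 h2
  · rw [dist0_intCast (by rw [h1]; omega), dist0_intCast (by rw [h2]; omega), h1, h2]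
    exact h'
  · apply hR
    rw [dist0_intCast (by rw [h1]; omega), dist0_intCast (by rw [h2]; omega), h1, h2]
    exact h'

lemma sum_wt_le [NeZero m] (a b : ZMod m) (h0 : ¬(a = 0 ∧ b = 0))
    (h : 2 * (dist0 a + dist0 b) < m) :
    wt (dist0 b) (dist0 (b - 2 * a)) + wt (dist0 b) (dist0 (b + 2 * a)) +
      (wt (dist0 a) (dist0 (a - 2 * b)) + wt (dist0 a) (dist0 (a + 2 * b))) ≤ 73 / 20 := by
  have hz : ∀ c : ZMod m, dist0 c = 0 → c = 0 := fun c hc =>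
    (valMinAbs_eq_zero c).1 (Int.natAbs_eq_zero.1 hc)
  refine dist0_sub_add_two_mul a b h
    (fun u v => wt (dist0 b) u + wt (dist0 b) v + _ ≤ _) (fun u v H => by linarith) ?_
  refine dist0_sub_add_two_mul b a (by omega)
    (fun u v => _ + (wt (dist0 a) u + wt (dist0 a) v) ≤ _) (fun u v H => by linarith) ?_
  refine sum_wt_min_le h ?_
  by_contra hc
  push Not at hc
  exact h0 ⟨hz a hc.1, hz b hc.2⟩

/-- The shear of the first coordinate along the second. -/
def shear₁ (t : ZMod m) : ZMod m × ZMod m ≃ ZMod m × ZMod m where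
  toFun z := (z.1 + (2 * z.2 + t), z.2)
  invFun z := (z.1 - (2 * z.2 + t), z.2)
  left_inv z := by simp
  right_inv z := by simp

/-- The shear of the second coordinate along the first. -/
def shear₂ (t : ZMod m) : ZMod m × ZMod m ≃ ZMod m × ZMod m where
  toFun z := (z.1, z.2 + (2 * z.1 + t))
  invFun z := (z.1, z.2 - (2 * z.1 + t))
  left_inv z := by simp
  right_inv z := by simp

@[simp] lemma shear₁_apply (t : ZMod m) (z : ZMod m × ZMod m) :
    shear₁ t z = (z.1 + (2 * z.2 + t), z.2) := rfl
@[simp] lemma shear₂_apply (t : ZMod m) (z : ZMod m × ZMod m) :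
    shear₂ t z = (z.1, z.2 + (2 * z.1 + t)) := rfl
@[simp] lemma shear₁_symm_apply (t : ZMod m) (z : ZMod m × ZMod m) :
    (shear₁ t).symm z = (z.1 - (2 * z.2 + t), z.2) := rfl
@[simp] lemma shear₂_symm_apply (t : ZMod m) (z : ZMod m × ZMod m) :
    (shear₂ t).symm z = (z.1, z.2 - (2 * z.1 + t)) := rfl

/-! ### Fourier analysis on the torus. -/

variable [NeZero m]

/-- The modulus of the multiplier `1 + e(a / m)`. -/
noncomputable def amp (a : ZMod m) : ℝ := ‖1 + stdAddChar a‖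

lemma amp_nonneg (a : ZMod m) : 0 ≤ amp a := norm_nonneg _

lemma amp_neg (a : ZMod m) : amp (-a) = amp a := by
  have h : stdAddChar (-a) = (starRingEnd ℂ) (stdAddChar a) := by
    rw [AddChar.map_neg_eq_conj]
  rw [amp, h, amp, ← Complex.norm_conj (1 + stdAddChar a)]
  simp

/-- By the half-angle formula `|1 + exp(2iθ)| = 2 |cos θ|`, and the cosine is nonnegative because
the representative of least absolute value gives `θ ≤ π/2`. -/
lemma amp_eq (a : ZMod m) : amp a = 2 * Real.cos (Real.pi * dist0 a / m) := by
  have hm : (0 : ℝ) < m := by exact_mod_cast Nat.pos_of_ne_zero (NeZero.ne m)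
  have key : ∀ t : ℕ, 2 * t ≤ m →
      amp (t : ZMod m) = 2 * Real.cos (Real.pi * t / m) := by
    intro t ht
    have hc : 0 ≤ Real.cos (Real.pi * t / m) := by
      apply Real.cos_nonneg_of_mem_Icc
      constructor
      · have : 0 ≤ Real.pi * t / m := by positivity
        linarith [Real.pi_pos]
      · rw [div_le_iff₀ hm]
        have : (2 * t : ℝ) ≤ m := by exact_mod_cast ht
        nlinarith [Real.pi_pos]
    have h1 := stdAddChar_coe (N := m) (t : ℤ)
    rw [Int.cast_natCast] at h1
    rw [amp, h1]
    set θ : ℝ := Real.pi * t / m with hθ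
    have h2 : (2 * Real.pi * Complex.I * ((t : ℤ) : ℂ) / m : ℂ) = (2 * θ : ℝ) * Complex.I := by
      rw [hθ]; push_cast; ring
    rw [h2, ← Real.sqrt_sq (by positivity : 0 ≤ 2 * Real.cos θ), Complex.norm_def]
    congr 1
    rw [Complex.normSq_apply]
    simp only [Complex.add_re, Complex.one_re, Complex.exp_ofReal_mul_I_re, Complex.add_im,
      Complex.one_im, Complex.exp_ofReal_mul_I_im]
    rw [Real.cos_two_mul, Real.sin_two_mul]
    nlinarith [Real.sin_sq_add_cos_sq θ]
  have hd := two_mul_dist0_le a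
  rcases Int.natAbs_eq a.valMinAbs with h | h
  · have : a = ((dist0 a : ℕ) : ZMod m) := by
      conv_lhs => rw [← coe_valMinAbs a, h]
      simp [dist0]
    conv_lhs => rw [this]
    exact key _ hd
  · have : a = -((dist0 a : ℕ) : ZMod m) := by
      conv_lhs => rw [← coe_valMinAbs a, h]
      simp [dist0]
    conv_lhs => rw [this]
    rw [amp_neg]
    exact key _ hd

lemma amp_le (a : ZMod m) : amp a ≤ 2 := by
  rw [amp_eq]; linarith [Real.cos_le_one (Real.pi * dist0 a / m)]

/-- The two angles add up to at least `π/2`, so `cos β ≤ sin α`, and `cos α + sin α ≤ √2`. -/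
lemma amp_add_amp_le (a b : ZMod m) (h : m ≤ 2 * (dist0 a + dist0 b)) :
    amp a + amp b ≤ 2 * Real.sqrt 2 := by
  have hm : (0 : ℝ) < m := by exact_mod_cast Nat.pos_of_ne_zero (NeZero.ne m)
  rw [amp_eq, amp_eq]
  set α := Real.pi * dist0 a / m with hα
  set β := Real.pi * dist0 b / m with hβ
  have hα2 : α ≤ Real.pi / 2 := by
    rw [hα, div_le_iff₀ hm]
    have : (2 * dist0 a : ℝ) ≤ m := by exact_mod_cast two_mul_dist0_le a
    nlinarith [Real.pi_pos]
  have hβ2 : β ≤ Real.pi := by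
    rw [hβ, div_le_iff₀ hm]
    have : (2 * dist0 b : ℝ) ≤ m := by exact_mod_cast two_mul_dist0_le b
    nlinarith [Real.pi_pos]
  have hsum : Real.pi / 2 ≤ α + β := by
    rw [hα, hβ, ← add_div, le_div_iff₀ hm]
    have : (m : ℝ) ≤ 2 * (dist0 a + dist0 b) := by exact_mod_cast h
    nlinarith [Real.pi_pos]
  have h1 : Real.cos β ≤ Real.sin α := by
    rw [← Real.cos_pi_div_two_sub]
    exact Real.cos_le_cos_of_nonneg_of_le_pi (by linarith) hβ2 (by linarith)
  have h2 : Real.cos α + Real.sin α ≤ Real.sqrt 2 := by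
    apply Real.le_sqrt_of_sq_le
    nlinarith [Real.sin_sq_add_cos_sq α, sq_nonneg (Real.cos α - Real.sin α)]
  linarith

/-- Near the origin the multipliers are at most 2 and the weights add up to at most 73/20. Elsewhere
each weight is at most 5/4 and the multipliers add up to at most `2√2`, giving `5√2 < 73/10`. -/
lemma weighted_amp_le (a b : ZMod m) (h0 : ¬(a = 0 ∧ b = 0)) :
    amp a * (wt (dist0 b) (dist0 (b - 2 * a)) + wt (dist0 b) (dist0 (b + 2 * a))) +
      amp b * (wt (dist0 a) (dist0 (a - 2 * b)) + wt (dist0 a) (dist0 (a + 2 * b)))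
        ≤ 73 / 10 := by
  by_cases h : 2 * (dist0 a + dist0 b) < m
  · have h1 := sum_wt_le a b h0 h
    have := wt_nonneg (dist0 b) (dist0 (b - 2 * a))
    have := wt_nonneg (dist0 b) (dist0 (b + 2 * a))
    have := wt_nonneg (dist0 a) (dist0 (a - 2 * b))
    have := wt_nonneg (dist0 a) (dist0 (a + 2 * b))
    nlinarith [amp_le a, amp_le b]
  · have h1 := amp_add_amp_le a b (by omega)
    have h2 : Real.sqrt 2 ≤ 73 / 50 := by
      rw [Real.sqrt_le_left (by norm_num)]; norm_num
    have := wt_le (dist0 b) (dist0 (b - 2 * a))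
    have := wt_le (dist0 b) (dist0 (b + 2 * a))
    have := wt_le (dist0 a) (dist0 (a - 2 * b))
    have := wt_le (dist0 a) (dist0 (a + 2 * b))
    nlinarith [amp_nonneg a, amp_nonneg b]

/-- The estimate on the Fourier side. -/
lemma sum_amp_mul_le (g : ZMod m × ZMod m → ℝ) (hg0 : g 0 = 0) :
    ∑ z, (amp z.1 * (g z * g ((shear₂ 0).symm z)) + amp z.2 * (g z * g ((shear₁ 0).symm z))) ≤
      73 / 20 * ∑ z, g z ^ 2 := by
  have A : ∀ z : ZMod m × ZMod m, amp z.1 * (2 * (g z * g ((shear₂ 0).symm z))) ≤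
      amp z.1 * (wt (dist0 z.2) (dist0 (z.2 - 2 * z.1)) * g z ^ 2 +
        wt (dist0 (z.2 - 2 * z.1)) (dist0 z.2) * g ((shear₂ 0).symm z) ^ 2) := fun z =>
    mul_le_mul_of_nonneg_left (two_mul_le_wt _ _ _ _) (amp_nonneg _)
  have B : ∀ z : ZMod m × ZMod m, amp z.2 * (2 * (g z * g ((shear₁ 0).symm z))) ≤
      amp z.2 * (wt (dist0 z.1) (dist0 (z.1 - 2 * z.2)) * g z ^ 2 +
        wt (dist0 (z.1 - 2 * z.2)) (dist0 z.1) * g ((shear₁ 0).symm z) ^ 2) := fun z =>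
    mul_le_mul_of_nonneg_left (two_mul_le_wt _ _ _ _) (amp_nonneg _)
  have A' : ∑ z : ZMod m × ZMod m,
      amp z.1 * (wt (dist0 (z.2 - 2 * z.1)) (dist0 z.2) * g ((shear₂ 0).symm z) ^ 2) =
      ∑ z : ZMod m × ZMod m,
        amp z.1 * (wt (dist0 z.2) (dist0 (z.2 + 2 * z.1)) * g z ^ 2) := by
    -- The substitution charges the neighbour's share of the AM–GM bound to the point itself, which
    -- collects the weights towards both of its neighbours.
    rw [← Equiv.sum_comp (shear₂ 0)]
    refine sum_congr rfl fun z _ => ?_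
    simp
  have B' : ∑ z : ZMod m × ZMod m,
      amp z.2 * (wt (dist0 (z.1 - 2 * z.2)) (dist0 z.1) * g ((shear₁ 0).symm z) ^ 2) =
      ∑ z : ZMod m × ZMod m,
        amp z.2 * (wt (dist0 z.1) (dist0 (z.1 + 2 * z.2)) * g z ^ 2) := by
    rw [← Equiv.sum_comp (shear₁ 0)]
    refine sum_congr rfl fun z _ => ?_
    simp
  have C : ∀ z : ZMod m × ZMod m,
      amp z.1 * (wt (dist0 z.2) (dist0 (z.2 - 2 * z.1)) * g z ^ 2) +
      amp z.1 * (wt (dist0 z.2) (dist0 (z.2 + 2 * z.1)) * g z ^ 2) +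
      (amp z.2 * (wt (dist0 z.1) (dist0 (z.1 - 2 * z.2)) * g z ^ 2) +
      amp z.2 * (wt (dist0 z.1) (dist0 (z.1 + 2 * z.2)) * g z ^ 2)) ≤ 73 / 10 * g z ^ 2 := by
    intro z
    -- At the origin the coefficient is 8, which is too large; the vanishing of `g` there is what
    -- saves the bound.
    by_cases hz : z = 0
    · simp [hz, hg0]
    · have := weighted_amp_le z.1 z.2 (fun h => hz (Prod.ext h.1 h.2))
      nlinarith [sq_nonneg (g z)]
  have SA := sum_le_sum fun z (_ : z ∈ univ) => A z
  have SB := sum_le_sum fun z (_ : z ∈ univ) => B z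
  have SC := sum_le_sum fun z (_ : z ∈ univ) => C z
  simp only [mul_add, sum_add_distrib] at SA SB SC
  rw [A'] at SA
  rw [B'] at SB
  rw [← mul_sum] at SC
  have h1 : ∑ z : ZMod m × ZMod m, amp z.1 * (2 * (g z * g ((shear₂ 0).symm z))) =
      2 * ∑ z : ZMod m × ZMod m, amp z.1 * (g z * g ((shear₂ 0).symm z)) := by
    rw [mul_sum]; exact sum_congr rfl fun z _ => by ring
  have h2 : ∑ z : ZMod m × ZMod m, amp z.2 * (2 * (g z * g ((shear₁ 0).symm z))) =
      2 * ∑ z : ZMod m × ZMod m, amp z.2 * (g z * g ((shear₁ 0).symm z)) := by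
    rw [mul_sum]; exact sum_congr rfl fun z _ => by ring
  rw [h1] at SA
  rw [h2] at SB
  rw [sum_add_distrib]
  linarith

/-- The Fourier transform on `(ℤ/m)²`. -/
noncomputable def fourier (f : ZMod m × ZMod m → ℂ) (a : ZMod m × ZMod m) : ℂ :=
  ∑ z, stdAddChar (a.1 * z.1 + a.2 * z.2) * f z

lemma sum_stdAddChar (z : ZMod m × ZMod m) :
    ∑ a : ZMod m × ZMod m, stdAddChar (a.1 * z.1 + a.2 * z.2) =
      if z = 0 then ((m : ℂ) ^ 2) else 0 := by
  simp_rw [AddChar.map_add_eq_mul]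
  rw [Fintype.sum_prod_type]
  simp_rw [← mul_sum]
  rw [← sum_mul, AddChar.sum_mulShift _ (isPrimitive_stdAddChar m),
    AddChar.sum_mulShift _ (isPrimitive_stdAddChar m)]
  by_cases h1 : z.1 = 0 <;> by_cases h2 : z.2 = 0 <;> simp [h1, h2, Prod.ext_iff, ZMod.card, sq]

/-- Parseval's identity, from the orthogonality of characters. -/
lemma sum_conj_fourier_mul (f g : ZMod m × ZMod m → ℂ) :
    ∑ a, (starRingEnd ℂ) (fourier f a) * fourier g a =
      (m : ℂ) ^ 2 * ∑ z, (starRingEnd ℂ) (f z) * g z := by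
  have h : ∀ a : ZMod m × ZMod m, (starRingEnd ℂ) (fourier f a) * fourier g a =
      ∑ z : ZMod m × ZMod m, ∑ w : ZMod m × ZMod m, (starRingEnd ℂ) (f z) * g w *
        stdAddChar (a.1 * (w - z).1 + a.2 * (w - z).2) := by
    intro a
    rw [fourier, fourier, map_sum, sum_mul_sum]
    refine sum_congr rfl fun z _ => sum_congr rfl fun w _ => ?_
    rw [map_mul, ← AddChar.map_neg_eq_conj]
    have : a.1 * (w - z).1 + a.2 * (w - z).2 =
        -(a.1 * z.1 + a.2 * z.2) + (a.1 * w.1 + a.2 * w.2) := by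
      simp; ring
    rw [this]
    generalize -(a.1 * z.1 + a.2 * z.2) = s
    generalize a.1 * w.1 + a.2 * w.2 = t
    rw [AddChar.map_add_eq_mul]
    ring
  simp_rw [h]
  rw [sum_comm]
  rw [mul_sum]
  refine sum_congr rfl fun z _ => ?_
  rw [sum_comm]
  simp_rw [← mul_sum, sum_stdAddChar, sub_eq_zero]
  simp
  ring

/-- Substituting the inverse shear lets its transpose act on the frequency. The translation `t`
becomes a phase. -/
lemma fourier_comp_shear₁ (f : ZMod m × ZMod m → ℂ) (t : ZMod m) (a : ZMod m × ZMod m) :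
    fourier (fun z => f (shear₁ t z)) a =
      stdAddChar (-(a.1 * t)) * fourier f ((shear₂ 0).symm a) := by
  rw [fourier, ← Equiv.sum_comp (shear₁ t).symm, fourier, mul_sum]
  refine sum_congr rfl fun z _ => ?_
  rw [Equiv.apply_symm_apply, ← mul_assoc, ← AddChar.map_add_eq_mul]
  congr 2
  simp; ring

lemma fourier_comp_shear₂ (f : ZMod m × ZMod m → ℂ) (t : ZMod m) (a : ZMod m × ZMod m) :
    fourier (fun z => f (shear₂ t z)) a =
      stdAddChar (-(a.2 * t)) * fourier f ((shear₁ 0).symm a) := by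
  rw [fourier, ← Equiv.sum_comp (shear₂ t).symm, fourier, mul_sum]
  refine sum_congr rfl fun z _ => ?_
  rw [Equiv.apply_symm_apply, ← mul_assoc, ← AddChar.map_add_eq_mul]
  congr 2
  simp; ring

lemma fourier_add (f g : ZMod m × ZMod m → ℂ) (a : ZMod m × ZMod m) :
    fourier (fun z => f z + g z) a = fourier f a + fourier g a := by
  simp [fourier, mul_add, sum_add_distrib]

/-- By Parseval the correlation moves to the Fourier side, where the phases for `t = 0` and `t = 1`
combine into the factor `amp`. Mean zero says that the transform vanishes at frequency `0`. -/
lemma sum_mul_shear_le (f : ZMod m × ZMod m → ℝ) (hf : ∑ z, f z = 0) :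
    ∑ z, f z * (f (shear₁ 0 z) + f (shear₁ 1 z) + (f (shear₂ 0 z) + f (shear₂ 1 z))) ≤
      73 / 20 * ∑ z, f z ^ 2 := by
  have hm : (0 : ℝ) < (m : ℝ) ^ 2 := by
    have : (0 : ℝ) < m := by exact_mod_cast Nat.pos_of_ne_zero (NeZero.ne m)
    positivity
  set F : ZMod m × ZMod m → ℂ := fun z => (f z : ℂ) with hF
  have hF0 : ‖fourier F 0‖ = 0 := by
    have : fourier F 0 = ((∑ z, f z : ℝ) : ℂ) := by simp [fourier, hF]
    rw [this, hf]; simp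
  have P1 := sum_conj_fourier_mul F F
  have P2 := sum_conj_fourier_mul F
    (fun z => F (shear₁ 0 z) + F (shear₁ 1 z) + (F (shear₂ 0 z) + F (shear₂ 1 z)))
  have key := sum_amp_mul_le (fun a => ‖fourier F a‖) hF0
  have E1 : ∑ a, ‖fourier F a‖ ^ 2 = (m : ℝ) ^ 2 * ∑ z, f z ^ 2 := by
    have : ((∑ a, ‖fourier F a‖ ^ 2 : ℝ) : ℂ) = (((m : ℝ) ^ 2 * ∑ z, f z ^ 2 : ℝ) : ℂ) := by
      push_cast
      rw [← sum_congr rfl fun a _ => Complex.conj_mul' (fourier F a), P1]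
      congr 1
      refine sum_congr rfl fun z _ => ?_
      simp [hF, sq]
    exact_mod_cast this
  rw [E1] at key
  have E2 : (m : ℝ) ^ 2 * ∑ z, f z * (f (shear₁ 0 z) + f (shear₁ 1 z) +
      (f (shear₂ 0 z) + f (shear₂ 1 z))) = (∑ a, (starRingEnd ℂ) (fourier F a) *
      fourier (fun z => F (shear₁ 0 z) + F (shear₁ 1 z) +
        (F (shear₂ 0 z) + F (shear₂ 1 z))) a).re := by
    rw [P2]
    have : (∑ z, (starRingEnd ℂ) (F z) * (F (shear₁ 0 z) + F (shear₁ 1 z) +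
        (F (shear₂ 0 z) + F (shear₂ 1 z)))) = ((∑ z, f z * (f (shear₁ 0 z) + f (shear₁ 1 z) +
      (f (shear₂ 0 z) + f (shear₂ 1 z))) : ℝ) : ℂ) := by
      push_cast
      refine sum_congr rfl fun z _ => ?_
      simp only [hF, Complex.conj_ofReal]
    rw [this]
    norm_cast
  have E3 : (∑ a, (starRingEnd ℂ) (fourier F a) *
      fourier (fun z => F (shear₁ 0 z) + F (shear₁ 1 z) +
        (F (shear₂ 0 z) + F (shear₂ 1 z))) a).re ≤
      ∑ z, (amp z.1 * (‖fourier F z‖ * ‖fourier F ((shear₂ 0).symm z)‖) +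
        amp z.2 * (‖fourier F z‖ * ‖fourier F ((shear₁ 0).symm z)‖)) := by
    refine (Complex.re_le_norm _).trans ((norm_sum_le _ _).trans (sum_le_sum fun a _ => ?_))
    rw [fourier_add, fourier_add (fun z => F (shear₁ 0 z)), fourier_add (fun z => F (shear₂ 0 z)),
      fourier_comp_shear₁, fourier_comp_shear₁, fourier_comp_shear₂, fourier_comp_shear₂]
    simp only [mul_zero, neg_zero, AddChar.map_zero_eq_one, mul_one]
    rw [← add_mul, ← add_mul, mul_add]
    refine (norm_add_le _ _).trans (le_of_eq ?_)
    rw [norm_mul, norm_mul, norm_mul, norm_mul, RCLike.norm_conj]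
    change _ * (amp (-a.1) * _) + _ * (amp (-a.2) * _) = _
    rw [amp_neg, amp_neg]
    ring
  have := E2.trans_le (E3.trans key)
  nlinarith

/-- The Dirichlet form of the Gabber–Galil graph bounds the variance. -/
theorem sum_sq_le_dirichlet (f : ZMod m × ZMod m → ℝ) (hf : ∑ z, f z = 0) :
    7 / 10 * ∑ z, f z ^ 2 ≤
      ∑ z, ((f z - f (shear₁ 0 z)) ^ 2 + (f z - f (shear₁ 1 z)) ^ 2 +
        ((f z - f (shear₂ 0 z)) ^ 2 + (f z - f (shear₂ 1 z)) ^ 2)) := by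
  have h := sum_mul_shear_le f hf
  have h1 := Equiv.sum_comp (shear₁ (m := m) 0) (fun z => f z ^ 2)
  have h2 := Equiv.sum_comp (shear₁ (m := m) 1) (fun z => f z ^ 2)
  have h3 := Equiv.sum_comp (shear₂ (m := m) 0) (fun z => f z ^ 2)
  have h4 := Equiv.sum_comp (shear₂ (m := m) 1) (fun z => f z ^ 2)
  -- Shears preserve the sum of squares, so the Dirichlet form is 8 times that sum minus twice the
  -- correlation, and `8 - 2 · 73/20 = 7/10`.
  have e : ∀ z, ((f z - f (shear₁ 0 z)) ^ 2 + (f z - f (shear₁ 1 z)) ^ 2 +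
        ((f z - f (shear₂ 0 z)) ^ 2 + (f z - f (shear₂ 1 z)) ^ 2)) =
      4 * f z ^ 2 + f (shear₁ 0 z) ^ 2 + f (shear₁ 1 z) ^ 2 + f (shear₂ 0 z) ^ 2 +
      f (shear₂ 1 z) ^ 2 - 2 * (f z * (f (shear₁ 0 z) + f (shear₁ 1 z) +
        (f (shear₂ 0 z) + f (shear₂ 1 z)))) := fun z => by ring
  rw [sum_congr rfl fun z _ => e z]
  simp only [sum_add_distrib, sum_sub_distrib, ← mul_sum]
  rw [h1, h2, h3, h4]
  linarith

end GabberGalil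

/-! ### Numbers given by their digits -/

open Finset in
lemma sum_range_mul_eq {M : Type*} [AddCommMonoid M] (B N : ℕ) (g : ℕ → M) :
    ∑ x ∈ range (B * N), g x = ∑ a ∈ range N, ∑ d ∈ range B, g (d + B * a) := by
  induction N with
  | zero => simp
  | succ N ih =>
    rw [Nat.mul_succ, sum_range_add, ih, sum_range_succ]
    simp [add_comm]

/-- The number with base `B` digits `d 0, …, d (K - 1)`, least significant first. -/
def ofDigitFun (B : ℕ) (d : ℕ → ℕ) (K : ℕ) : ℕ := ∑ i ∈ Finset.range K, d i * B ^ i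

lemma ofDigitFun_succ (B : ℕ) (d : ℕ → ℕ) (K : ℕ) :
    ofDigitFun B d (K + 1) = ofDigitFun B d K + d K * B ^ K := Finset.sum_range_succ _ _

lemma ofDigitFun_lt {B : ℕ} {d : ℕ → ℕ} {K : ℕ} (hd : ∀ i < K, d i < B) :
    ofDigitFun B d K < B ^ K := by
  induction K with
  | zero => simp [ofDigitFun]
  | succ K ih =>
    have h1 := ih fun i hi => hd i (by omega)
    have h2 : (d K + 1) * B ^ K ≤ B * B ^ K := Nat.mul_le_mul_right _ (hd K (by omega))
    rw [ofDigitFun_succ, pow_succ']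
    rw [add_mul, one_mul] at h2
    omega

lemma ofDigitFun_digit {B : ℕ} {d : ℕ → ℕ} {K : ℕ} (hB : 0 < B) (hd : ∀ i < K, d i < B)
    {i : ℕ} (hi : i < K) : ofDigitFun B d K / B ^ i % B = d i := by
  induction K with
  | zero => omega
  | succ K ih =>
    rw [ofDigitFun_succ]
    rcases Nat.lt_succ_iff_lt_or_eq.1 hi with h | h
    · obtain ⟨e, rfl⟩ := Nat.exists_eq_add_of_lt h
      have : d (i + e + 1) * B ^ (i + e + 1) = (B * (d (i + e + 1) * B ^ e)) * B ^ i := by ring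
      rw [this, Nat.add_mul_div_right _ _ (pow_pos hB i), Nat.add_mul_mod_self_left]
      exact ih (fun j hj => hd j (by omega)) h
    · subst h
      have h1 := ofDigitFun_lt fun j (hj : j < i) => hd j (by omega)
      rw [Nat.add_mul_div_right _ _ (pow_pos hB i), Nat.div_eq_of_lt h1, zero_add,
        Nat.mod_eq_of_lt (hd i hi)]

lemma ofDigitFun_digits (B n K : ℕ) : ofDigitFun B (fun i => n / B ^ i % B) K = n % B ^ K := by
  induction K with
  | zero => simp [ofDigitFun, Nat.mod_one]
  | succ K ih => rw [ofDigitFun_succ, ih, Nat.mod_pow_succ, mul_comm]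

lemma ofDigitFun_congr {B : ℕ} {d e : ℕ → ℕ} {K : ℕ} (h : ∀ i < K, d i = e i) :
    ofDigitFun B d K = ofDigitFun B e K :=
  Finset.sum_congr rfl fun i hi => by rw [h i (Finset.mem_range.1 hi)]

/-! ### Interleaved pairs of binary numbers -/

/-- The number formed by the bits of `X` in even positions. -/
def evenPart (K X : ℕ) : ℕ := ofDigitFun 2 (fun i => X / 4 ^ i % 4 % 2) K

/-- The number formed by the bits of `X` in odd positions. -/
def oddPart (K X : ℕ) : ℕ := ofDigitFun 2 (fun i => X / 4 ^ i % 4 / 2) K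

/-- The number with the bits of `x` in even and those of `y` in odd positions. -/
def interleave (K x y : ℕ) : ℕ := ofDigitFun 4 (fun i => x / 2 ^ i % 2 + 2 * (y / 2 ^ i % 2)) K

lemma evenPart_lt (K X : ℕ) : evenPart K X < 2 ^ K :=
  ofDigitFun_lt fun i _ => by omega

lemma oddPart_lt (K X : ℕ) : oddPart K X < 2 ^ K :=
  ofDigitFun_lt fun i _ => by omega

lemma interleave_lt (K x y : ℕ) : interleave K x y < 4 ^ K :=
  ofDigitFun_lt fun i _ => by omega

lemma evenPart_digit {K X i : ℕ} (hi : i < K) :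
    evenPart K X / 2 ^ i % 2 = X / 4 ^ i % 4 % 2 :=
  ofDigitFun_digit (by norm_num) (fun i _ => by omega) hi

lemma oddPart_digit {K X i : ℕ} (hi : i < K) :
    oddPart K X / 2 ^ i % 2 = X / 4 ^ i % 4 / 2 :=
  ofDigitFun_digit (by norm_num) (fun i _ => by omega) hi

lemma interleave_digit {K x y i : ℕ} (hi : i < K) :
    interleave K x y / 4 ^ i % 4 = x / 2 ^ i % 2 + 2 * (y / 2 ^ i % 2) :=
  ofDigitFun_digit (by norm_num) (fun i _ => by omega) hi

lemma evenPart_interleave {K x y : ℕ} (hx : x < 2 ^ K) : evenPart K (interleave K x y) = x := by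
  rw [evenPart, ofDigitFun_congr (e := fun i => x / 2 ^ i % 2), ofDigitFun_digits,
    Nat.mod_eq_of_lt hx]
  intro i hi
  rw [interleave_digit hi]; omega

lemma oddPart_interleave {K x y : ℕ} (hy : y < 2 ^ K) : oddPart K (interleave K x y) = y := by
  rw [oddPart, ofDigitFun_congr (e := fun i => y / 2 ^ i % 2), ofDigitFun_digits,
    Nat.mod_eq_of_lt hy]
  intro i hi
  rw [interleave_digit hi]; omega

lemma interleave_parts {K X : ℕ} (hX : X < 4 ^ K) :
    interleave K (evenPart K X) (oddPart K X) = X := by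
  rw [interleave, ofDigitFun_congr (e := fun i => X / 4 ^ i % 4), ofDigitFun_digits,
    Nat.mod_eq_of_lt hX]
  intro i hi
  rw [evenPart_digit hi, oddPart_digit hi]; omega

/-! ### The shears on binary numbers -/

/-- `p ± (2 q + b)` modulo `2 ^ K`, with the minus sign if `σ` is set. -/
def addShift (K : ℕ) (σ b : Bool) (p q : ℕ) : ℕ :=
  if σ then (p + (2 ^ K - (2 * q + b.toNat) % 2 ^ K)) % 2 ^ K else (p + (2 * q + b.toNat)) % 2 ^ K

/-- The shear of one coordinate of an interleaved pair along the other. -/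
def shear (K : ℕ) (s σ b : Bool) (X : ℕ) : ℕ :=
  if s then interleave K (evenPart K X) (addShift K σ b (oddPart K X) (evenPart K X))
  else interleave K (addShift K σ b (evenPart K X) (oddPart K X)) (oddPart K X)

lemma addShift_lt (K : ℕ) (σ b : Bool) (p q : ℕ) : addShift K σ b p q < 2 ^ K := by
  unfold addShift
  split_ifs <;> exact Nat.mod_lt _ (by positivity)

lemma addShift_addShift {K : ℕ} (σ b : Bool) {p : ℕ} (q : ℕ) (hp : p < 2 ^ K) :
    addShift K (!σ) b (addShift K σ b p q) q = p := by
  have hM : 0 < 2 ^ K := by positivity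
  unfold addShift
  generalize 2 ^ K = M at *
  generalize 2 * q + b.toNat = r
  have hr := Nat.mod_lt r hM
  cases σ
  · simp only [Bool.not_false, if_true, Bool.false_eq_true, if_false]
    rw [Nat.mod_add_mod, add_assoc, Nat.add_mod]
    have : r + (M - r % M) = M * (r / M + 1) := by
      have := Nat.mod_add_div r M
      rw [mul_add, mul_one]; omega
    rw [this, Nat.mul_mod_right, add_zero, Nat.mod_mod, Nat.mod_eq_of_lt hp]
  · simp only [Bool.not_true, if_true, Bool.false_eq_true, if_false]
    rw [Nat.mod_add_mod, add_assoc, Nat.add_mod]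
    have : M - r % M + r = M * (r / M + 1) := by
      have := Nat.mod_add_div r M
      rw [mul_add, mul_one]; omega
    rw [this, Nat.mul_mod_right, add_zero, Nat.mod_mod, Nat.mod_eq_of_lt hp]

lemma shear_lt (K : ℕ) (s σ b : Bool) (X : ℕ) : shear K s σ b X < 4 ^ K := by
  unfold shear
  split_ifs <;> exact interleave_lt _ _ _

lemma shear_shear {K : ℕ} (s σ b : Bool) {X : ℕ} (hX : X < 4 ^ K) :
    shear K s (!σ) b (shear K s σ b X) = X := by
  cases s <;>
  simp only [shear, Bool.false_eq_true, if_false, if_true, evenPart_interleave (evenPart_lt K X),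
    oddPart_interleave (oddPart_lt K X), evenPart_interleave (addShift_lt _ _ _ _ _),
    oddPart_interleave (addShift_lt _ _ _ _ _), addShift_addShift _ _ _ (evenPart_lt K X),
    addShift_addShift _ _ _ (oddPart_lt K X), interleave_parts hX]

instance instNeZeroTwoPow (K : ℕ) : NeZero (2 ^ K) := ⟨by positivity⟩

/-- Interleaved pairs as points of the torus `(ℤ/2^K)²`. -/
def torusEquiv (K : ℕ) : ZMod (2 ^ K) × ZMod (2 ^ K) ≃ Fin (4 ^ K) where
  toFun z := ⟨interleave K z.1.val z.2.val, interleave_lt _ _ _⟩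
  invFun X := ((evenPart K X : ℕ), (oddPart K X : ℕ))
  left_inv z := by
    simp [evenPart_interleave (ZMod.val_lt z.1), oddPart_interleave (ZMod.val_lt z.2)]
  right_inv X := by
    ext
    simp only [ZMod.val_cast_of_lt (evenPart_lt K X), ZMod.val_cast_of_lt (oddPart_lt K X)]
    exact interleave_parts X.2

lemma val_add_shift {K : ℕ} (b : Bool) (x y : ZMod (2 ^ K)) :
    (x + (2 * y + (b.toNat : ZMod (2 ^ K)))).val = addShift K false b x.val y.val := by
  rw [addShift]
  simp only [Bool.false_eq_true, if_false]
  rw [← ZMod.val_natCast]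
  congr 1
  simp

lemma shear_torusEquiv_false {K : ℕ} (b : Bool) (z : ZMod (2 ^ K) × ZMod (2 ^ K)) :
    shear K false false b (torusEquiv K z) =
      torusEquiv K (GabberGalil.shear₁ (b.toNat : ZMod (2 ^ K)) z) := by
  simp [shear, torusEquiv, evenPart_interleave (ZMod.val_lt z.1),
    oddPart_interleave (ZMod.val_lt z.2), val_add_shift]

lemma shear_torusEquiv_true {K : ℕ} (b : Bool) (z : ZMod (2 ^ K) × ZMod (2 ^ K)) :
    shear K true false b (torusEquiv K z) =
      torusEquiv K (GabberGalil.shear₂ (b.toNat : ZMod (2 ^ K)) z) := by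
  simp [shear, torusEquiv, evenPart_interleave (ZMod.val_lt z.1),
    oddPart_interleave (ZMod.val_lt z.2), val_add_shift]

open Finset in
/-- The spectral gap of the shears on interleaved pairs. -/
lemma sum_sq_le_sum_shear (K : ℕ) (F : ℕ → ℝ) (hF : ∑ X ∈ range (4 ^ K), F X = 0) :
    7 / 10 * ∑ X ∈ range (4 ^ K), F X ^ 2 ≤
      ∑ X ∈ range (4 ^ K), ∑ s : Bool, ∑ b : Bool, (F X - F (shear K s false b X)) ^ 2 := by
  have conv : ∀ g : ℕ → ℝ, ∑ X ∈ range (4 ^ K), g X = ∑ z, g (torusEquiv K z) := by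
    intro g
    rw [← Fin.sum_univ_eq_sum_range, Equiv.sum_comp (torusEquiv K) (fun X => g X)]
  rw [conv] at hF
  rw [conv, conv]
  refine (GabberGalil.sum_sq_le_dirichlet (fun z => F (torusEquiv K z)) hF).trans
    (le_of_eq (sum_congr rfl fun z _ => ?_))
  simp only [Fintype.sum_bool, shear_torusEquiv_false, shear_torusEquiv_true]
  simp only [Bool.toNat_true, Bool.toNat_false, Nat.cast_one, Nat.cast_zero]
  ring

/-! ### The base graphs -/

/-- The number of base `4` digits of `n`. -/
def quadDigits (n : ℕ) : ℕ := (n.size + 1) / 2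

lemma lt_four_pow_quadDigits (n : ℕ) : n < 4 ^ quadDigits n := by
  have h := Nat.lt_size_self n
  refine h.trans_le ?_
  rw [show (4 : ℕ) = 2 ^ 2 by norm_num, ← pow_mul]
  exact Nat.pow_le_pow_right (by norm_num) (by unfold quadDigits; omega)

/-- This is why four sheets are enough: every point of the torus is `v + j n` with `v < n` and `j <
4`. -/
lemma four_pow_quadDigits_le {n : ℕ} (hn : 0 < n) : 4 ^ quadDigits n ≤ 4 * n := by
  have h0 := Nat.size_pos.2 hn
  have h : 2 ^ (n.size - 1) ≤ n := Nat.lt_size.1 (by omega)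
  have : 4 ^ quadDigits n ≤ 4 * 2 ^ (n.size - 1) := by
    rw [show (4 : ℕ) = 2 ^ 2 by norm_num, ← pow_mul, ← pow_add]
    exact Nat.pow_le_pow_right (by norm_num) (by unfold quadDigits; omega)
  omega

/-- An edge label: whether to move at all, the sheet `j`, the coordinate, the sign and the bit of
the shear. -/
abbrev Label := Bool × Fin 4 × Bool × Bool × Bool

/-- An enumeration of the labels. -/
noncomputable def labelEquiv : Fin 64 ≃ Label :=
  (Fintype.equivFinOfCardEq (by simp [Label])).symm

/-- The rotation map of the base graph on `n` vertices. The point `X = v + j n` of the torus lies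
over the vertex `v`. -/
noncomputable def hop (n v : ℕ) (d : Fin 64) : ℕ × Fin 64 :=
  match labelEquiv d with
  | (go, j, s, σ, b) =>
    if go = true ∧ v + j * n < 4 ^ quadDigits n then
      (shear (quadDigits n) s σ b (v + j * n) % n,
        labelEquiv.symm (go, Fin.ofNat 4 (shear (quadDigits n) s σ b (v + j * n) / n), s, !σ, b))
    else (v, d)

lemma hop_lt {n v : ℕ} (hv : v < n) (d : Fin 64) : (hop n v d).1 < n := by
  unfold hop
  rcases labelEquiv d with ⟨go, j, s, σ, b⟩
  dsimp only
  split_ifs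
  · exact Nat.mod_lt _ (by omega)
  · exact hv

lemma hop_hop {n v : ℕ} (hv : v < n) (d : Fin 64) :
    hop n (hop n v d).1 (hop n v d).2 = (v, d) := by
  obtain ⟨l, rfl⟩ := labelEquiv.symm.surjective d
  obtain ⟨go, j, s, σ, b⟩ := l
  by_cases h : go = true ∧ v + j * n < 4 ^ quadDigits n
  · have hX' := shear_lt (quadDigits n) s σ b (v + j * n)
    have e : hop n v (labelEquiv.symm (go, j, s, σ, b)) =
        (shear (quadDigits n) s σ b (v + j * n) % n, labelEquiv.symm (go,
          Fin.ofNat 4 (shear (quadDigits n) s σ b (v + j * n) / n), s, !σ, b)) := by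
      rw [hop, Equiv.apply_symm_apply]; simp only [h, and_self, if_true]
    rw [e]
    -- The sheet of the sheared point is less than 4, so `Fin.ofNat` loses nothing.
    have hj : ((Fin.ofNat 4 (shear (quadDigits n) s σ b (v + j * n) / n) : Fin 4) : ℕ) =
        shear (quadDigits n) s σ b (v + j * n) / n := by
      rw [Fin.val_ofNat, Nat.mod_eq_of_lt]
      rw [Nat.div_lt_iff_lt_mul (by omega)]
      exact hX'.trans_le (four_pow_quadDigits_le (by omega))
    rw [hop, Equiv.apply_symm_apply]
    dsimp only
    rw [hj, Nat.mod_add_div', if_pos ⟨h.1, hX'⟩, shear_shear _ _ _ h.2, Bool.not_not,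
      Nat.add_mul_mod_self_right, Nat.mod_eq_of_lt hv, Nat.add_mul_div_right _ _ (by omega),
      Nat.div_eq_of_lt hv, zero_add, Fin.ofNat_eq_cast, Fin.cast_val_eq_self]
  · have e : hop n v (labelEquiv.symm (go, j, s, σ, b)) =
        (v, labelEquiv.symm (go, j, s, σ, b)) := by
      rw [hop, Equiv.apply_symm_apply]; simp only [h, if_false]
    rw [e, e]

/-! ### The spectral gap of the base graphs. -/

section Spectral

open Finset

/-- The rotation map permutes the pairs of a vertex and a label. -/
lemma sum_hop (n : ℕ) (f : ℕ → ℝ) :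
    ∑ v ∈ range n, ∑ d, f (hop n v d).1 = 64 * ∑ v ∈ range n, f v := by
  have h : ∑ p ∈ range n ×ˢ (univ : Finset (Fin 64)), f (hop n p.1 p.2).1 =
      ∑ p ∈ range n ×ˢ (univ : Finset (Fin 64)), f p.1 := by
    refine sum_nbij' (fun p => hop n p.1 p.2) (fun p => hop n p.1 p.2) ?_ ?_ ?_ ?_ ?_
    · rintro ⟨v, d⟩ h
      simp only [mem_product, mem_range, mem_univ, and_true] at h ⊢
      exact hop_lt h d
    · rintro ⟨v, d⟩ h
      simp only [mem_product, mem_range, mem_univ, and_true] at h ⊢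
      exact hop_lt h d
    · rintro ⟨v, d⟩ h
      simp only [mem_product, mem_range, mem_univ, and_true] at h
      exact hop_hop h d
    · rintro ⟨v, d⟩ h
      simp only [mem_product, mem_range, mem_univ, and_true] at h
      exact hop_hop h d
    · intro p _; rfl
  rw [sum_product, sum_product] at h
  rw [h]
  simp [mul_sum]

lemma sum_labels (g : Label → ℝ) :
    ∑ d, g (labelEquiv d) = ∑ j : Fin 4, ∑ s : Bool, ∑ b : Bool,
      (g (true, j, s, false, b) + g (true, j, s, true, b)) +
      ∑ l : Fin 4 × Bool × Bool × Bool, g (false, l) := by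
  rw [Equiv.sum_comp labelEquiv g, Fintype.sum_prod_type, Fintype.sum_bool]
  congr 1
  simp only [Fintype.sum_prod_type, Fintype.sum_bool]
  refine sum_congr rfl fun j _ => by ring

/-- The Dirichlet form of the base graph, restricted to the labels that move. -/
lemma sum_sq_le_sum_hop {n : ℕ} (f : ℕ → ℝ) (hf : ∑ v ∈ range n, f v = 0) :
    7 / 10 * ∑ v ∈ range n, f v ^ 2 ≤
      ∑ v ∈ range n, ∑ d, (f v - f (hop n v d).1) ^ 2 := by
  rcases Nat.eq_zero_or_pos n with rfl | hn
  · simp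
  set N := 4 ^ quadDigits n with hN
  have hnN : n ≤ N := (lt_four_pow_quadDigits n).le
  have hN0 : (0 : ℝ) < N := by rw [hN]; positivity
  -- Vertices have different numbers of preimages, so the lift need not have mean zero and must be
  -- centred.
  set c : ℝ := (∑ X ∈ range N, f (X % n)) / N with hc
  set F : ℕ → ℝ := fun X => f (X % n) - c with hF
  have hF0 : ∑ X ∈ range N, F X = 0 := by
    simp only [hF, sum_sub_distrib, sum_const, card_range, nsmul_eq_mul]
    rw [hc]; field_simp; simp
  have h1 := sum_sq_le_sum_shear (quadDigits n) F hF0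
  have h2 : ∑ v ∈ range n, f v ^ 2 ≤ ∑ X ∈ range N, F X ^ 2 := by
    -- Sheet `0` alone already carries enough mass: the cross term vanishes since `f` has mean zero,
    -- and the centring only adds `n c²`.
    have : ∑ v ∈ range n, F v ^ 2 = ∑ v ∈ range n, f v ^ 2 + n * c ^ 2 := by
      rw [sum_congr rfl (g := fun v => f v ^ 2 - 2 * c * f v + c ^ 2)]
      · rw [sum_add_distrib, sum_sub_distrib, ← mul_sum, hf]; simp
      · intro v hv
        simp only [hF, Nat.mod_eq_of_lt (mem_range.1 hv)]; ring
    have h3 : ∑ v ∈ range n, F v ^ 2 ≤ ∑ X ∈ range N, F X ^ 2 :=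
      sum_le_sum_of_subset_of_nonneg (range_subset_range.2 hnN) fun i _ _ => sq_nonneg _
    have : 0 ≤ (n : ℝ) * c ^ 2 := by positivity
    linarith
  set h : ℕ → ℝ := fun X => ∑ s : Bool, ∑ b : Bool,
    (F X - F (shear (quadDigits n) s false b X)) ^ 2 with hh
  have h3 : ∑ X ∈ range N, h X ≤
      ∑ X ∈ range (n * 4), if X < N then h X else 0 := by
    rw [← sum_filter]
    refine sum_le_sum_of_subset_of_nonneg ?_ ?_
    · intro X hX
      have := four_pow_quadDigits_le hn
      simp only [mem_filter, mem_range] at hX ⊢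
      exact ⟨by omega, hX⟩
    · intro i _ _; rw [hh]; positivity
  rw [sum_range_mul_eq, sum_comm (s := range 4)] at h3
  have h4 : ∀ v ∈ range n, (∑ j ∈ range 4, if v + n * j < N then h (v + n * j) else 0) ≤
      ∑ d, (f v - f (hop n v d).1) ^ 2 := by
    intro v hv
    have hv := mem_range.1 hv
    have e := sum_labels (fun l : Label => (f v - f (hop n v (labelEquiv.symm l)).1) ^ 2)
    simp only [Equiv.symm_apply_apply] at e
    rw [e]
    have e2 : (0 : ℝ) ≤ ∑ l : Fin 4 × Bool × Bool × Bool,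
      (fun l : Label => (f v - f (hop n v (labelEquiv.symm l)).1) ^ 2) (false, l) :=
      sum_nonneg fun _ _ => sq_nonneg _
    refine le_trans ?_ (le_add_of_nonneg_right e2)
    rw [← Fin.sum_univ_eq_sum_range (fun j => if v + n * j < N then h (v + n * j) else 0) 4]
    refine sum_le_sum fun j _ => ?_
    split_ifs with hj
    · rw [hh]
      refine sum_le_sum fun s _ => sum_le_sum fun b _ => ?_
      -- The term of the inverse shear is dropped; the forward shears suffice.
      refine le_trans (le_of_eq ?_) (le_add_of_nonneg_right (sq_nonneg _))
      rw [mul_comm] at hj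
      have e3 : (hop n v (labelEquiv.symm (true, j, s, false, b))).1 =
          shear (quadDigits n) s false b (v + j * n) % n := by
        rw [hop, Equiv.apply_symm_apply]
        dsimp only
        rw [if_pos ⟨rfl, hj⟩]
      rw [e3, mul_comm n]
      simp only [hF, Nat.add_mul_mod_self_right, Nat.mod_eq_of_lt hv]
      ring
    · exact sum_nonneg fun _ _ => sum_nonneg fun _ _ => by positivity
  have h5 := sum_le_sum h4
  linarith

/-- The random walk operator of the base graph. -/
noncomputable def hopAvg (n : ℕ) (f : ℕ → ℝ) (v : ℕ) : ℝ := (∑ d, f (hop n v d).1) / 64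

lemma sum_hopAvg (n : ℕ) (f : ℕ → ℝ) : ∑ v ∈ range n, hopAvg n f v = ∑ v ∈ range n, f v := by
  unfold hopAvg
  rw [← sum_div, sum_hop]; ring

lemma hop_fst_of_stay (n v : ℕ) (l : Fin 4 × Bool × Bool × Bool) :
    (hop n v (labelEquiv.symm (false, l))).1 = v := by
  obtain ⟨j, s, σ, b⟩ := l
  rw [hop, Equiv.apply_symm_apply]; simp

/-- Thanks to the 32 labels that stay, the average is `1/64` times a sum of 32 terms `f v + g l`.
Cauchy–Schwarz and `(x + y)² = 2x² + 2y² - (x - y)²` bring in the Dirichlet form, and the constant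
is `1 - (7/10)/128 = 1273/1280`. -/
lemma sum_hopAvg_sq_le {n : ℕ} (f : ℕ → ℝ) (hf : ∑ v ∈ range n, f v = 0) :
    ∑ v ∈ range n, hopAvg n f v ^ 2 ≤ 1273 / 1280 * ∑ v ∈ range n, f v ^ 2 := by
  have split : ∀ g : Fin 64 → ℝ, ∑ d, g d =
      ∑ l : Fin 4 × Bool × Bool × Bool, g (labelEquiv.symm (true, l)) +
      ∑ l : Fin 4 × Bool × Bool × Bool, g (labelEquiv.symm (false, l)) := by
    intro g
    rw [← Equiv.sum_comp labelEquiv.symm g, Fintype.sum_prod_type, Fintype.sum_bool]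
  have E := sum_sq_le_sum_hop f hf
  have Q := sum_hop n (fun v => f v ^ 2)
  have key : ∀ v, hopAvg n f v ^ 2 ≤ (1 / 128) * (2 * ∑ d, f (hop n v d).1 ^ 2 -
      ∑ d, (f v - f (hop n v d).1) ^ 2) := by
    intro v
    rw [hopAvg, split, split, split]
    simp only [hop_fst_of_stay, sub_self]
    set g : Fin 4 × Bool × Bool × Bool → ℝ :=
      fun l => f (hop n v (labelEquiv.symm (true, l))).1 with hg
    have e1 : ∑ l, f (hop n v (labelEquiv.symm (true, l))).1 +
        ∑ l : Fin 4 × Bool × Bool × Bool, f v = ∑ l, (f v + g l) := by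
      rw [sum_add_distrib, add_comm]
    have cs := sq_sum_le_card_mul_sum_sq (s := univ) (f := fun l => f v + g l)
    have e2 : ∑ l, (f v + g l) ^ 2 = 2 * (∑ l, g l ^ 2 +
        ∑ l : Fin 4 × Bool × Bool × Bool, f v ^ 2) - ∑ l, (f v - g l) ^ 2 := by
      rw [← sum_add_distrib, mul_sum, ← sum_sub_distrib]
      exact sum_congr rfl fun l _ => by ring
    rw [e1]
    rw [e2] at cs
    have hcard : ((univ : Finset (Fin 4 × Bool × Bool × Bool)).card : ℝ) = 32 := by
      rw [card_univ]; norm_num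
    rw [hcard] at cs
    simp only [hg] at cs ⊢
    have z : ∑ l : Fin 4 × Bool × Bool × Bool, (0 : ℝ) ^ 2 = 0 := by simp
    rw [z, add_zero, div_pow]
    linarith
  have S := sum_le_sum fun v (_ : v ∈ range n) => key v
  rw [← mul_sum, sum_sub_distrib, ← mul_sum, Q] at S
  linarith

end Spectral

/-! ### Walks on the base graphs -/

/-- One step of the walk: pushes the label of the reversed edge. -/
noncomputable def walkStep (n : ℕ) (p : ℕ × List (Fin 64)) (d : Fin 64) : ℕ × List (Fin 64) :=
  ((hop n p.1 d).1, (hop n p.1 d).2 :: p.2)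

/-- The end of the walk from `v` along the labels `l`, and the labels of the reversed walk. -/
noncomputable def walk (n v : ℕ) (l : List (Fin 64)) : ℕ × List (Fin 64) :=
  l.foldl (walkStep n) (v, [])

lemma foldl_walkStep (n v : ℕ) (l B : List (Fin 64)) :
    l.foldl (walkStep n) (v, B) = ((walk n v l).1, (walk n v l).2 ++ B) := by
  induction l generalizing v B with
  | nil => simp [walk]
  | cons d l ih =>
    rw [walk, List.foldl_cons, List.foldl_cons, walkStep, walkStep, ih, ih]
    simp

lemma walk_cons (n v : ℕ) (d : Fin 64) (l : List (Fin 64)) :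
    walk n v (d :: l) =
      ((walk n (hop n v d).1 l).1, (walk n (hop n v d).1 l).2 ++ [(hop n v d).2]) := by
  rw [walk, List.foldl_cons, walkStep, foldl_walkStep]

lemma walk_length (n v : ℕ) (l : List (Fin 64)) : (walk n v l).2.length = l.length := by
  induction l generalizing v with
  | nil => rfl
  | cons d l ih => rw [walk_cons]; simp [ih]

lemma walk_lt {n v : ℕ} (hv : v < n) (l : List (Fin 64)) : (walk n v l).1 < n := by
  induction l generalizing v with
  | nil => exact hv
  | cons d l ih => rw [walk_cons]; exact ih (hop_lt hv d)

/-- The labels of the reversed edges are stacked, so the last edge comes first on the way back. -/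
lemma walk_walk {n v : ℕ} (hv : v < n) (l : List (Fin 64)) :
    walk n (walk n v l).1 (walk n v l).2 = (v, l) := by
  induction l generalizing v with
  | nil => rfl
  | cons d l ih =>
    rw [walk_cons]
    have h := ih (hop_lt hv d)
    rw [walk] at h ⊢
    rw [List.foldl_append, h, List.foldl_cons, List.foldl_nil, walkStep, hop_hop hv]

/-- The `t` least significant base `64` digits of `a`. -/
def digitList (t a : ℕ) : List (Fin 64) := (List.range t).map fun i => Fin.ofNat 64 (a / 64 ^ i)

/-- The number with given base `64` digits. -/
def ofDigitList : List (Fin 64) → ℕ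
  | [] => 0
  | d :: l => d + 64 * ofDigitList l

@[simp] lemma digitList_length (t a : ℕ) : (digitList t a).length = t := by simp [digitList]

lemma digitList_succ (t a : ℕ) :
    digitList (t + 1) a = Fin.ofNat 64 a :: digitList t (a / 64) := by
  rw [digitList, List.range_succ_eq_map]
  simp [digitList, pow_succ', Nat.div_div_eq_div_mul]

lemma ofDigitList_lt (l : List (Fin 64)) : ofDigitList l < 64 ^ l.length := by
  induction l with
  | nil => simp [ofDigitList]
  | cons d l ih =>
    rw [ofDigitList, List.length_cons, pow_succ']
    have := d.2
    omega

lemma digitList_ofDigitList (l : List (Fin 64)) : digitList l.length (ofDigitList l) = l := by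
  induction l with
  | nil => rfl
  | cons d l ih =>
    have := d.2
    rw [List.length_cons, digitList_succ, ofDigitList]
    congr 1
    · ext; simp only [Fin.val_ofNat]; omega
    · rw [show (d + 64 * ofDigitList l) / 64 = ofDigitList l by omega, ih]

lemma ofDigitList_digitList {t a : ℕ} (ha : a < 64 ^ t) : ofDigitList (digitList t a) = a := by
  induction t generalizing a with
  | zero => simp at ha; simp [digitList, ofDigitList, ha]
  | succ t ih =>
    rw [digitList_succ, ofDigitList, ih (by rw [pow_succ'] at ha; omega)]
    simp only [Fin.val_ofNat]; omega

lemma ofDigitList_div_mod (l : List (Fin 64)) (i : ℕ) :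
    ofDigitList l / 64 ^ i % 64 = ((l[i]?.getD 0 : Fin 64) : ℕ) := by
  induction l generalizing i with
  | nil => simp [ofDigitList]
  | cons d l ih =>
    have := d.2
    cases i with
    | zero => simp [ofDigitList]
    | succ i =>
      rw [ofDigitList, pow_succ', ← Nat.div_div_eq_div_mul,
        show (d + 64 * ofDigitList l) / 64 = ofDigitList l by omega, ih]
      simp

/-- The graph of the walks of length `t` on the base graph. -/
noncomputable def walkGraph (n t c : ℕ) (hc : c = 64 ^ t) : LabeledGraph n c where
  rot p := (⟨(walk n p.1 (digitList t p.2)).1, walk_lt p.1.2 _⟩,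
    ⟨ofDigitList (walk n p.1 (digitList t p.2)).2, by
      have := ofDigitList_lt (walk n p.1 (digitList t p.2)).2
      rwa [walk_length, digitList_length, ← hc] at this⟩)
  rot_involutive := by
    rintro ⟨v, a⟩
    have h : digitList t (ofDigitList (walk n v (digitList t a)).2) =
        (walk n v (digitList t a)).2 := by
      have := digitList_ofDigitList (walk n v (digitList t a)).2
      rwa [walk_length, digitList_length] at this
    ext
    · simp only [h, walk_walk v.2]
    · simp only [h, walk_walk v.2]
      rw [ofDigitList_digitList (hc ▸ a.2)]

/-! ### The spectral bound for walks. -/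

section Spectral

open Finset

/-- The random walk operator of the graph of walks of length `t`. -/
noncomputable def walkAvg (n t : ℕ) (f : ℕ → ℝ) (v : ℕ) : ℝ :=
  (∑ a ∈ range (64 ^ t), f (walk n v (digitList t a)).1) / 64 ^ t

/-- The least significant digit of a label is the first step of the walk, so averaging over it is
the outer operator. -/
lemma walkAvg_succ (n t : ℕ) (f : ℕ → ℝ) : walkAvg n (t + 1) f = hopAvg n (walkAvg n t f) := by
  funext v
  rw [walkAvg, hopAvg, pow_succ', sum_range_mul_eq, sum_comm]
  simp only [walkAvg]
  rw [← sum_div, div_div, pow_succ, mul_comm]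
  rw [← Fin.sum_univ_eq_sum_range (fun y => ∑ x ∈ range (64 ^ t),
    f (walk n v (digitList (t + 1) (y + 64 * x))).1) 64]
  congr 1
  refine sum_congr rfl fun d _ => sum_congr rfl fun a _ => ?_
  have hd := d.2
  have e : Fin.ofNat 64 (d + 64 * a) = d := by ext; simp only [Fin.val_ofNat]; omega
  rw [digitList_succ, walk_cons, e, show (d + 64 * a) / 64 = a by omega]

lemma walkAvg_zero (n : ℕ) (f : ℕ → ℝ) : walkAvg n 0 f = f := by
  funext v; simp [walkAvg, digitList, walk]

lemma sum_walkAvg (n t : ℕ) (f : ℕ → ℝ) :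
    ∑ v ∈ range n, walkAvg n t f v = ∑ v ∈ range n, f v := by
  induction t with
  | zero => rw [walkAvg_zero]
  | succ t ih => rw [walkAvg_succ, sum_hopAvg, ih]

lemma sum_walkAvg_sq_le {n : ℕ} (t : ℕ) (f : ℕ → ℝ) (hf : ∑ v ∈ range n, f v = 0) :
    ∑ v ∈ range n, walkAvg n t f v ^ 2 ≤ (1273 / 1280) ^ t * ∑ v ∈ range n, f v ^ 2 := by
  induction t with
  | zero => rw [walkAvg_zero]; simp
  | succ t ih =>
    rw [walkAvg_succ]
    have := sum_hopAvg_sq_le (walkAvg n t f) (by rw [sum_walkAvg, hf])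
    rw [pow_succ']
    linarith

lemma LabeledGraph.transition_mulVec {n c : ℕ} (G : LabeledGraph n c) (v : Fin n → ℝ) (u : Fin n) :
    G.transition.mulVec v u = (c : ℝ)⁻¹ * ∑ i, v (G.rot (u, i)).1 := by
  rw [LabeledGraph.transition, Matrix.smul_mulVec, Pi.smul_apply, smul_eq_mul]
  congr 1
  simp only [Matrix.mulVec, dotProduct, LabeledGraph.adj, Matrix.of_apply]
  rw [← sum_fiberwise' univ (fun i => (G.rot (u, i)).1) v]
  refine sum_congr rfl fun w _ => ?_
  simp

/-- The bound on the second eigenvalue of the base graphs. -/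
noncomputable def baseLam : ℝ := Real.sqrt (1273 / 1280)

lemma baseLam_pos : 0 < baseLam := Real.sqrt_pos.2 (by norm_num)

lemma baseLam_lt_one : baseLam < 1 := by
  rw [baseLam, Real.sqrt_lt' one_pos]; norm_num

lemma sqrt_pow_eq {x : ℝ} (hx : 0 ≤ x) (t : ℕ) : Real.sqrt (x ^ t) = Real.sqrt x ^ t := by
  rw [Real.sqrt_eq_iff_mul_self_eq (by positivity) (by positivity), ← mul_pow,
    Real.mul_self_sqrt hx]

lemma walkGraph_lam_le (n t c : ℕ) (hc : c = 64 ^ t) :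
    (walkGraph n t c hc).lam ≤ baseLam ^ t := by
  refine Real.sSup_le ?_ (pow_nonneg baseLam_pos.le _)
  rintro r ⟨v, hv0, hv, rfl⟩
  rw [div_le_iff₀ (norm_pos_iff.2 hv0)]
  set f : ℕ → ℝ := fun i => if h : i < n then v ⟨i, h⟩ else 0 with hf
  have hfv : ∀ i : Fin n, f i = v i := fun i => by simp [hf]
  have hf0 : ∑ i ∈ range n, f i = 0 := by
    rw [← Fin.sum_univ_eq_sum_range]; simpa [hfv] using hv
  have hT : ∀ u : Fin n, (walkGraph n t c hc).transition.mulVec v.ofLp u = walkAvg n t f u := by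
    intro u
    rw [LabeledGraph.transition_mulVec, walkAvg, inv_mul_eq_div, ← hc,
      ← Fin.sum_univ_eq_sum_range (fun a => f (walk n u (digitList t a)).1) c]
    rw [show ((64 : ℝ) ^ t) = c by rw [hc]; push_cast; rfl]
    congr 1
    refine sum_congr rfl fun i _ => ?_
    exact (hfv ((walkGraph n t c hc).rot (u, i)).1).symm
  have h := sum_walkAvg_sq_le t f hf0
  rw [EuclideanSpace.norm_eq, EuclideanSpace.norm_eq, baseLam,
    ← sqrt_pow_eq (by norm_num), ← Real.sqrt_mul (by positivity)]
  apply Real.sqrt_le_sqrt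
  simp only [hT, ← hfv, Real.norm_eq_abs, sq_abs]
  rw [Fin.sum_univ_eq_sum_range (fun i => walkAvg n t f i ^ 2) n,
    Fin.sum_univ_eq_sum_range (fun i => f i ^ 2) n]
  exact h

end Spectral

/-! ### The family and the choice of its degrees. -/

/-- The family of all graphs of walks of positive length on the base graphs. -/
noncomputable def walkFamily : GraphFamily where
  index := {p | 1 < p.1 ∧ ∃ t, 0 < t ∧ p.2 = 64 ^ t}
  pos := by
    rintro n c ⟨hn, t, -, hc⟩
    exact ⟨zero_lt_one.trans hn, by rw [show c = 64 ^ t from hc]; positivity⟩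
  graph n c h := walkGraph n h.2.choose c h.2.choose_spec.2

lemma walkFamily_isExpander : walkFamily.IsExpander := by
  refine ⟨baseLam, baseLam_lt_one, fun n c h => ?_⟩
  refine (walkGraph_lam_le n _ c h.2.choose_spec.2).trans ?_
  exact pow_le_of_le_one baseLam_pos.le baseLam_lt_one.le h.2.choose_spec.1.ne'

/-- The least sufficient length is taken; that the length before it fails is what bounds the degree.
-/
lemma exists_walk_length {lambda : ℝ} (h0 : 0 < lambda) (h1 : lambda < 1) :
    ∃ t : ℕ, baseLam ^ (t + 1) ≤ lambda ∧ lambda < baseLam ^ t := by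
  have hex : ∃ t : ℕ, baseLam ^ t ≤ lambda := by
    obtain ⟨t, ht⟩ := exists_pow_lt_of_lt_one h0 baseLam_lt_one
    exact ⟨t, ht.le⟩
  classical
  have hs := Nat.find_spec hex
  have hne : Nat.find hex ≠ 0 := by
    intro h; rw [h, pow_zero] at hs; linarith
  obtain ⟨t, ht⟩ := Nat.exists_eq_succ_of_ne_zero hne
  refine ⟨t, by rwa [ht] at hs, ?_⟩
  exact not_le.1 (Nat.find_min hex (by omega))

lemma exists_degree :
    ∃ (len : ℝ → ℕ) (p : Polynomial ℝ), ∀ lambda : ℝ, 0 < lambda → lambda < 1 →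
      baseLam ^ (len lambda + 1) ≤ lambda ∧
        ((64 ^ (len lambda + 1) : ℕ) : ℝ) ≤ p.eval (1 / lambda) := by
  -- This `e` is the degree of the polynomial: `64 ^ t ≤ (1 / baseLam ^ t) ^ e ≤ (1 / λ) ^ e`, and
  -- one more step costs the factor 64.
  obtain ⟨e, he⟩ : ∃ e : ℕ, 64 < (1 / baseLam) ^ e :=
    pow_unbounded_of_one_lt _ ((one_lt_div baseLam_pos).2 baseLam_lt_one)
  refine ⟨fun x => if h : 0 < x ∧ x < 1 then (exists_walk_length h.1 h.2).choose else 0,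
    Polynomial.C 64 * Polynomial.X ^ e, fun x h0 h1 => ?_⟩
  have hx : 0 < x ∧ x < 1 := ⟨h0, h1⟩
  simp only [hx, and_self, dif_pos]
  obtain ⟨ha, hb⟩ := (exists_walk_length h0 h1).choose_spec
  generalize (exists_walk_length h0 h1).choose = t at ha hb
  refine ⟨ha, ?_⟩
  simp only [Polynomial.eval_mul, Polynomial.eval_C, Polynomial.eval_pow, Polynomial.eval_X]
  push_cast
  rw [pow_succ']
  refine mul_le_mul_of_nonneg_left ?_ (by norm_num)
  calc (64 : ℝ) ^ t ≤ ((1 / baseLam) ^ e) ^ t := pow_le_pow_left₀ (by norm_num) he.le t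
    _ = (1 / baseLam ^ t) ^ e := by rw [← pow_mul, mul_comm, pow_mul, one_div_pow]
    _ ≤ (1 / x) ^ e := by
      refine pow_le_pow_left₀ ?_ (one_div_le_one_div_of_le h0 hb.le) e
      exact div_nonneg zero_le_one (pow_nonneg baseLam_pos.le _)

/-! ### Bounded reachability between configurations -/

namespace OfflineTM

variable {M : OfflineTM}

/-- `M` reaches `C'` from `C` in at most `T` steps, with all heads on the cells `0, …, S` up to and
including the last step. -/
inductive ReachLE (M : OfflineTM) (x : List IOSym) (S : ℕ) : ℕ → M.Config → M.Config → Prop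
  | refl {T : ℕ} {C : M.Config} (h : ∀ i, C.head i ≤ S) : ReachLE M x S T C C
  | step {T : ℕ} {C C₁ C₂ : M.Config} (h : ∀ i, C.head i ≤ S) (hs : M.step x C = some C₁)
      (hr : ReachLE M x S T C₁ C₂) : ReachLE M x S (T + 1) C C₂

namespace ReachLE

variable {x : List IOSym} {S : ℕ}

lemma mono {T T' : ℕ} {C C' : M.Config} (h : ReachLE M x S T C C') (hT : T ≤ T') :
    ReachLE M x S T' C C' := by
  induction h generalizing T' with
  | refl h => exact refl h
  | step h hs _ ih =>
    obtain ⟨T', rfl⟩ : ∃ k, T' = k + 1 := ⟨T' - 1, by omega⟩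
    exact step h hs (ih (by omega))

lemma trans {T T' : ℕ} {C C' C'' : M.Config} (h : ReachLE M x S T C C')
    (h' : ReachLE M x S T' C' C'') : ReachLE M x S (T + T') C C'' := by
  induction h with
  | refl _ => exact h'.mono (by omega)
  | step h hs _ ih =>
    rw [Nat.add_right_comm]
    exact step h hs (ih h')

lemma exists_run {T : ℕ} {C C' : M.Config} (h : ReachLE M x S T C C') {s : ℕ}
    (hC : M.run x s = C) :
    ∃ t ≤ T, M.run x (s + t) = C' ∧ ∀ r ≤ t, ∀ i, (M.run x (s + r)).head i ≤ S := by
  induction h generalizing s with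
  | refl h =>
    refine ⟨0, Nat.zero_le _, hC, fun r hr i => ?_⟩
    rw [Nat.le_zero.1 hr, add_zero, hC]
    exact h i
  | step h hs _ ih =>
    obtain ⟨t, ht, he, hh⟩ := ih (s := s + 1) (by rw [run, hC, hs]; rfl)
    refine ⟨t + 1, by omega, by rw [← he]; congr 1; omega, fun r hr i => ?_⟩
    rcases r with _ | r
    · rw [add_zero, hC]; exact h i
    · have := hh r (by omega) i
      rwa [show s + 1 + r = s + (r + 1) by omega] at this

lemma computesWithin {T : ℕ} {C' : M.Config} (h : ReachLE M x S T M.init C')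
    (hs : M.step x C' = none) : M.ComputesWithin x C'.out T (M.tapes * (S + 1)) := by
  obtain ⟨t, ht, he, hh⟩ := h.exists_run (s := 0) rfl
  rw [zero_add] at he
  refine ⟨t, ht, by rw [he, hs], by rw [he], ?_⟩
  calc M.space x t ≤ ∑ _i : Fin M.tapes, (S + 1) := by
        refine Finset.sum_le_sum fun i _ => ?_
        calc _ ≤ (Finset.range (S + 1)).card := by
              refine Finset.card_le_card fun k hk => ?_
              simp only [Finset.mem_image, Finset.mem_range] at hk ⊢
              obtain ⟨r, hr, rfl⟩ := hk
              have := hh r (by omega) i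
              rw [zero_add] at this
              omega
          _ = S + 1 := Finset.card_range _
    _ = M.tapes * (S + 1) := by simp

end ReachLE

end OfflineTM

/-! ### A machine that computes the rotation maps -/

namespace WalkMachine

/-- A cell of the work tape: marks for the leftmost cell, for the cells in use and for the cells
that hold digits of `n`; base `4` digits of `n`, of the current vertex and of four candidates for
the next vertex; base `64` digits of the labels ahead and of the labels behind; and marks telling
whether a nonzero digit of the vertex or of the labels behind lies further right. -/
@[ext] structure Cell where
  first : Bool
  used : Bool
  inN : Bool
  nd : Fin 4
  vd : Fin 4
  cand : Fin 4 → Fin 4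
  ad : Option (Fin 64)
  bd : Option (Fin 64)
  sv : Bool
  sb : Bool

instance : Finite Cell :=
  Finite.of_injective (fun c : Cell =>
    (c.first, c.used, c.inN, c.nd, c.vd, c.cand, c.ad, c.bd, c.sv, c.sb)) fun a b h => by
      simp only [Prod.mk.injEq] at h
      obtain ⟨h1, h2, h3, h4, h5, h6, h7, h8, h9, h10⟩ := h
      exact Cell.ext h1 h2 h3 h4 h5 h6 h7 h8 h9 h10

/-- The blank cell. -/
def blankCell : Cell := ⟨false, false, false, 0, 0, fun _ => 0, none, none, false, false⟩

/-- The control during a sweep to the right: the label of the current step (if any), the label to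
be moved into the next cell, the carry of `v + j n`, the carry and the delayed bit of the shear, and
the borrows of the candidates. -/
@[ext] structure Scan where
  act : Bool
  lab : Label
  bp : Option (Fin 64)
  cj : Fin 4
  cz : Bool
  zb : Bool
  bw : Fin 4 → Fin 4

instance : Finite Scan :=
  Finite.of_injective (fun s : Scan =>
    (s.act, s.lab, s.bp, s.cj, s.cz, s.zb, s.bw)) fun a b h => by
      simp only [Prod.mk.injEq] at h
      obtain ⟨h1, h2, h3, h4, h5, h6, h7⟩ := h
      exact Scan.ext h1 h2 h3 h4 h5 h6 h7

/-- The control during a sweep to the left: the selected candidate, the label of the reversed edge,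
the label to be moved into the next cell, and whether nonzero digits have been seen. -/
@[ext] structure Pick where
  sel : Option (Fin 4)
  res : Option (Fin 64)
  ap : Option (Fin 64)
  gv : Bool
  gb : Bool

instance : Finite Pick :=
  Finite.of_injective (fun s : Pick => (s.sel, s.res, s.ap, s.gv, s.gb)) fun a b h => by
      simp only [Prod.mk.injEq] at h
      obtain ⟨h1, h2, h3, h4, h5⟩ := h
      exact Pick.ext h1 h2 h3 h4 h5

namespace Scan

variable (s : Scan) (c : Cell)

/-- The control at the left end of the tape. -/
noncomputable def initial (d : Option (Fin 64)) (res : Option (Fin 64)) : Scan :=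
  let l := labelEquiv (d.getD 0)
  ⟨d.isSome, l, res, 0, l.2.2.2.1, l.2.2.2.2, fun _ => 0⟩

/-- The sum of the digits of `v + j n` in the current place. -/
def total : ℕ := c.vd + s.lab.2.1 * c.nd + s.cj

/-- The bit of the coordinate that the shear changes. -/
def pBit : ℕ := if s.lab.2.2.1 then s.total c % 4 / 2 else s.total c % 4 % 2

/-- The bit of the coordinate that the shear keeps. -/
def qBit : ℕ := if s.lab.2.2.1 then s.total c % 4 % 2 else s.total c % 4 / 2

/-- The sum of the bits of the shear in the current place. -/
def bitSum : ℕ := s.pBit c + (xor s.zb s.lab.2.2.2.1).toNat + s.cz.toNat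

/-- The base `4` digit of the sheared point. -/
def newDigit : ℕ :=
  if s.lab.2.2.1 then s.qBit c + 2 * (s.bitSum c % 2) else s.bitSum c % 2 + 2 * s.qBit c

/-- The difference of the digits for the candidate `j`, made nonnegative. -/
def diff (j : Fin 4) : ℕ := s.newDigit c + 12 - (j * c.nd + s.bw j)

/-- The control after a cell. -/
def next : Scan :=
  if c.inN then
    { s with
      bp := c.bd
      cj := Fin.ofNat 4 (s.total c / 4)
      cz := decide (s.bitSum c / 2 = 1)
      zb := decide (s.qBit c = 1)
      bw := fun j => Fin.ofNat 4 (3 - s.diff c j / 4) }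
  else { s with bp := c.bd }

/-- The symbol written into a cell. -/
def out : Cell := { c with cand := fun j => Fin.ofNat 4 (s.diff c j), bd := s.bp }

/-- The largest candidate without a borrow. -/
def sheet : Fin 4 :=
  if s.bw 3 = 0 then 3 else if s.bw 2 = 0 then 2 else if s.bw 1 = 0 then 1 else 0

/-- The control at the right end of the tape. -/
noncomputable def turn : Pick :=
  if s.act then
    if s.lab.1 ∧ s.cj = 0 then
      ⟨some s.sheet, some (labelEquiv.symm
        (s.lab.1, s.sheet, s.lab.2.2.1, !s.lab.2.2.2.1, s.lab.2.2.2.2)), none, false, false⟩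
    else ⟨none, some (labelEquiv.symm s.lab), none, false, false⟩
  else ⟨none, none, none, false, false⟩

end Scan

namespace Pick

variable (s : Pick) (c : Cell)

/-- The digit of the next vertex. -/
def digit : Fin 4 := if c.inN then (s.sel.map c.cand).getD c.vd else c.vd

/-- The control after a cell. -/
def next : Pick :=
  { s with
    ap := c.ad
    gv := s.gv || decide (s.digit c ≠ 0)
    gb := s.gb || decide (c.bd.getD 0 ≠ 0) }

/-- The symbol written into a cell. -/
def out : Cell := { c with vd := s.digit c, ad := s.ap, sv := s.gv, sb := s.gb }

end Pick

/-- The states of the machine. -/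
inductive Control where
  | start
  | read (w : Fin 4) (i : Fin 6)
  | back (w : Fin 4)
  | load (res : Option (Fin 64))
  | scan (s : Scan)
  | pick (s : Pick)
  | emit (w : Bool) (i : Fin 6)
  | rewind
  | halt

instance : Finite Control := by
  let f : Unit ⊕ (Fin 4 × Fin 6) ⊕ Fin 4 ⊕ Option (Fin 64) ⊕ Scan ⊕ Pick ⊕ (Bool × Fin 6) ⊕
      Unit ⊕ Unit → Control
    | .inl _ => .start
    | .inr (.inl (w, i)) => .read w i
    | .inr (.inr (.inl w)) => .back w
    | .inr (.inr (.inr (.inl r))) => .load r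
    | .inr (.inr (.inr (.inr (.inl s)))) => .scan s
    | .inr (.inr (.inr (.inr (.inr (.inl s))))) => .pick s
    | .inr (.inr (.inr (.inr (.inr (.inr (.inl (w, i))))))) => .emit w i
    | .inr (.inr (.inr (.inr (.inr (.inr (.inr (.inl _))))))) => .rewind
    | .inr (.inr (.inr (.inr (.inr (.inr (.inr (.inr _))))))) => .halt
  refine Finite.of_surjective f fun q => ?_
  cases q with
  | start => exact ⟨.inl (), rfl⟩
  | read w i => exact ⟨.inr (.inl (w, i)), rfl⟩
  | back w => exact ⟨.inr (.inr (.inl w)), rfl⟩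
  | load r => exact ⟨.inr (.inr (.inr (.inl r))), rfl⟩
  | scan s => exact ⟨.inr (.inr (.inr (.inr (.inl s)))), rfl⟩
  | pick s => exact ⟨.inr (.inr (.inr (.inr (.inr (.inl s))))), rfl⟩
  | emit w i => exact ⟨.inr (.inr (.inr (.inr (.inr (.inr (.inl (w, i))))))), rfl⟩
  | rewind => exact ⟨.inr (.inr (.inr (.inr (.inr (.inr (.inr (.inl ()))))))), rfl⟩
  | halt => exact ⟨.inr (.inr (.inr (.inr (.inr (.inr (.inr (.inr ()))))))), rfl⟩

/-- The number of bits per cell for each of the four input numbers. -/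
def blockBits (w : Fin 4) : ℕ := if w = 0 ∨ w = 2 then 2 else 6

/-- The number of bits per cell for each of the two output numbers. -/
def outBits (w : Bool) : ℕ := if w then 6 else 2

/-- The effect on a cell of reading the `i`-th bit of a block of the `w`-th input number. -/
def put (w : Fin 4) (i : ℕ) (b : Bool) (c : Cell) : Cell :=
  if w = 0 then { c with used := true, inN := true, nd := Fin.ofNat 4 (c.nd + b.toNat * 2 ^ i) }
  else if w = 1 then if i = 5 then { c with used := true, ad := some 0 } else c
  else if w = 2 then { c with vd := Fin.ofNat 4 (c.vd + b.toNat * 2 ^ i) }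
  else { c with ad := c.ad.map fun d => Fin.ofNat 64 (d + b.toNat * 2 ^ i) }

/-- The digit of an output number in a cell. -/
def outDigit (w : Bool) (c : Cell) : ℕ := if w then ((c.bd.getD 0 : Fin 64) : ℕ) else c.vd

/-- Whether a nonzero bit of an output number is in the `i`-th bit of the cell or beyond it. -/
def significant (w : Bool) (c : Cell) (i : ℕ) : Bool :=
  (if w then c.sb else c.sv) || decide (outDigit w c / 2 ^ i ≠ 0)

/-- The next state, the movement of the input head, the symbol written, the movement of the work
head and the output symbol. -/
noncomputable def delta : Control → Option IOSym → Cell →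
    Option (Control × HeadMove × Cell × HeadMove × Option IOSym)
  | .start, _, c => some (.read 0 0, .stay, { c with first := true, used := true }, .stay, none)
  | .read w i, some (.bit b), c =>
    if (i : ℕ) + 1 = blockBits w then some (.read w 0, .right, put w i b c, .right, none)
    else some (.read w (i + 1), .right, put w i b c, .stay, none)
  | .read w _, _, c => some (.back w, .right, c, .stay, none)
  | .back w, _, c =>
    if c.first then
      some (if w = 3 then .load none else .read (w + 1) 0, .stay, c, .stay, none)
    else some (.back w, .stay, c, .left, none)
  | .load r, _, c => some (.scan (Scan.initial c.ad r), .stay, c, .stay, none)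
  | .scan s, _, c =>
    if c.used then some (.scan (s.next c), .stay, s.out c, .right, none)
    else some (.pick s.turn, .stay, c, .left, none)
  | .pick s, _, c =>
    if c.first then
      some (if s.res.isSome then .load s.res else .emit false 0, .stay, s.out c, .stay, none)
    else some (.pick (s.next c), .stay, s.out c, .left, none)
  | .emit w i, _, c =>
    if significant w c i then
      if (i : ℕ) + 1 = outBits w then
        some (.emit w 0, .stay, c, .right, some (.bit ((outDigit w c).testBit i)))
      else some (.emit w (i + 1), .stay, c, .stay, some (.bit ((outDigit w c).testBit i)))
    else some (if w then .halt else .rewind, .stay, c, .stay, some .sep)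
  | .rewind, _, c =>
    if c.first then some (.emit true 0, .stay, c, .stay, none)
    else some (.rewind, .stay, c, .left, none)
  | .halt, _, _ => none

end WalkMachine

open WalkMachine in
/-- The machine that computes the rotation maps of `walkFamily`. -/
noncomputable def walkMachine : OfflineTM where
  State := Control
  Alphabet := Cell
  tapes := 1
  state_finite := inferInstance
  alphabet_finite := inferInstance
  blank := blankCell
  start := .start
  trans q a c := (delta q a (c 0)).map fun r =>
    ⟨r.1, r.2.1, fun _ => r.2.2.1, fun _ => r.2.2.2.1, r.2.2.2.2⟩

/-! ### The phases of the machine. -/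

namespace WalkMachine

open OfflineTM

/-- The configuration with given state, input head, work tape, work head and output. -/
noncomputable def conf (q : Control) (p : ℕ) (W : ℕ → Cell) (h : ℕ) (o : List IOSym) :
    walkMachine.Config :=
  { state := q, inHead := p, work := fun _ => W, head := fun _ => h, out := o }

lemma init_eq : walkMachine.init = conf .start 0 (fun _ => blankCell) 0 [] := rfl

lemma step_conf {x : List IOSym} {q q' : Control} {p : ℕ} {W : ℕ → Cell} {h : ℕ}
    {o : List IOSym} {im m : HeadMove} {c : Cell} {e : Option IOSym}
    (hd : delta q x[p]? (W h) = some (q', im, c, m, e)) :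
    walkMachine.step x (conf q p W h o) = some (conf q' (min (moveHead p im) x.length)
      (Function.update W h c) (moveHead h m) (o ++ e.toList)) := by
  have : walkMachine.trans q x[p]? (fun _ => W h) =
      some ⟨q', im, fun _ => c, fun _ => m, e⟩ := by
    change (delta q x[p]? (W h)).map _ = _
    rw [hd]; rfl
  change (walkMachine.trans q x[p]? (fun _ => W h)).map _ = _
  rw [this]
  rfl

lemma step_halt {x : List IOSym} {p : ℕ} {W : ℕ → Cell} {h : ℕ} {o : List IOSym} :
    walkMachine.step x (conf .halt p W h o) = none := rfl

/-- Bounded reachability for the machine `walkMachine`. -/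
abbrev Reach (x : List IOSym) (S T : ℕ) (C C' : walkMachine.Config) : Prop :=
  ReachLE walkMachine x S T C C'

section Reach

variable {x : List IOSym} {S : ℕ} {p : ℕ} {o : List IOSym}

lemma reach_step {q q' : Control} {W : ℕ → Cell} {h : ℕ}
    {im m : HeadMove} {c : Cell} {e : Option IOSym} {T : ℕ} {C : walkMachine.Config}
    (hh : h ≤ S) (hd : delta q x[p]? (W h) = some (q', im, c, m, e))
    (hr : Reach x S T (conf q' (min (moveHead p im) x.length)
      (Function.update W h c) (moveHead h m) (o ++ e.toList)) C) :
    Reach x S (T + 1) (conf q p W h o) C :=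
  .step (fun _ => hh) (step_conf hd) hr

lemma reach_refl {q : Control} {W : ℕ → Cell} {h T : ℕ} (hh : h ≤ S) :
    Reach x S T (conf q p W h o) (conf q p W h o) :=
  .refl fun _ => hh

/-- A step that keeps the input head. -/
lemma reach_step_stay {q q' : Control} {W : ℕ → Cell} {h : ℕ}
    {m : HeadMove} {c : Cell} {e : Option IOSym} {T : ℕ} {C : walkMachine.Config}
    (hp : p ≤ x.length) (hh : h ≤ S) (hd : delta q x[p]? (W h) = some (q', .stay, c, m, e))
    (hr : Reach x S T (conf q' p (Function.update W h c) (moveHead h m) (o ++ e.toList)) C) :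
    Reach x S (T + 1) (conf q p W h o) C := by
  refine reach_step hh hd ?_
  rwa [moveHead, min_eq_left hp]

lemma reach_back {w : Fin 4} {W : ℕ → Cell} {h : ℕ} (hp : p ≤ x.length) (hh : h ≤ S)
    (hW : ∀ j, (W j).first = decide (j = 0)) :
    Reach x S (h + 1) (conf (.back w) p W h o)
      (conf (if w = 3 then .load none else .read (w + 1) 0) p W 0 o) := by
  induction h with
  | zero =>
    refine reach_step_stay (e := none) hp hh
      (q' := if w = 3 then .load none else .read (w + 1) 0) (m := .stay) (c := W 0) ?_ ?_
    · rw [delta, hW 0]; simp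
    · rw [Function.update_eq_self]
      simpa [moveHead] using reach_refl (Nat.zero_le S)
  | succ h ih =>
    refine reach_step_stay (e := none) hp hh (q' := .back w) (m := .left) (c := W (h + 1)) ?_ ?_
    · rw [delta, hW]; simp
    · rw [Function.update_eq_self]
      simpa [moveHead] using ih (by omega)

lemma reach_rewind {W : ℕ → Cell} {h : ℕ} (hp : p ≤ x.length) (hh : h ≤ S)
    (hW : ∀ j, (W j).first = decide (j = 0)) :
    Reach x S (h + 1) (conf .rewind p W h o) (conf (.emit true 0) p W 0 o) := by
  induction h with
  | zero =>
    refine reach_step_stay (e := none) hp hh (q' := .emit true 0) (m := .stay) (c := W 0) ?_ ?_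
    · rw [delta, hW 0]; simp
    · rw [Function.update_eq_self]
      simpa [moveHead] using reach_refl (Nat.zero_le S)
  | succ h ih =>
    refine reach_step_stay (e := none) hp hh (q' := .rewind) (m := .left) (c := W (h + 1)) ?_ ?_
    · rw [delta, hW]; simp
    · rw [Function.update_eq_self]
      simpa [moveHead] using ih (by omega)

/-- A sweep to the right, described by invariants for the control and for the cells written. -/
lemma reach_scan {L : ℕ} (hp : p ≤ x.length) (hL : L ≤ S) (P : ℕ → Scan → Prop)
    (Q : ℕ → Cell → Prop) {W : ℕ → Cell} (hW : ∀ j, (W j).used = decide (j < L))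
    (hP : ∀ j < L, ∀ s, P j s → P (j + 1) (s.next (W j)))
    (hQ : ∀ j < L, ∀ s, P j s → Q j (s.out (W j))) {s : Scan} (hs : P 0 s) :
    ∃ s' W', P L s' ∧ (∀ j < L, Q j (W' j)) ∧ (∀ j, L ≤ j → W' j = W j) ∧
      Reach x S L (conf (.scan s) p W 0 o) (conf (.scan s') p W' L o) := by
  suffices h : ∀ k ≤ L, ∃ s' W', P k s' ∧ (∀ j < k, Q j (W' j)) ∧ (∀ j, k ≤ j → W' j = W j) ∧
      Reach x S k (conf (.scan s) p W 0 o) (conf (.scan s') p W' k o) from h L le_rfl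
  intro k
  induction k with
  | zero => exact fun _ => ⟨s, W, hs, by simp, fun _ _ => rfl, reach_refl (Nat.zero_le S)⟩
  | succ k ih =>
    intro hk
    obtain ⟨s', W', h1, h2, h3, h4⟩ := ih (by omega)
    refine ⟨s'.next (W k), Function.update W' k (s'.out (W k)), hP k hk s' h1, fun j hj => ?_,
      fun j hj => ?_, h4.trans ?_⟩
    · by_cases hjk : j = k
      · subst hjk; rw [Function.update_self]; exact hQ j hk s' h1
      · rw [Function.update_of_ne hjk]; exact h2 j (by omega)
    · rw [Function.update_of_ne (by omega)]; exact h3 j (by omega)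
    · refine reach_step_stay (e := none) hp (by omega) (q' := .scan (s'.next (W k))) (m := .right)
        (c := s'.out (W k)) ?_ ?_
      · rw [delta, h3 k le_rfl, hW]; simp; omega
      · simpa [moveHead] using reach_refl (T := 0) (by omega)

/-- A sweep to the left, described by invariants for the control and for the cells written. -/
lemma reach_pick {h : ℕ} (hp : p ≤ x.length) (hh : h ≤ S) (P : ℕ → Pick → Prop)
    (Q : ℕ → Cell → Prop) {W : ℕ → Cell} (hW : ∀ j, (W j).first = decide (j = 0))
    (hP : ∀ j s, j + 1 ≤ h → P (j + 1) s → P j (s.next (W (j + 1))))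
    (hQ : ∀ j s, j ≤ h → P j s → Q j (s.out (W j))) {s : Pick} (hs : P h s) :
    ∃ W', (∀ j ≤ h, Q j (W' j)) ∧ (∀ j, h < j → W' j = W j) ∧
      Reach x S (h + 1) (conf (.pick s) p W h o)
        (conf (if s.res.isSome then .load s.res else .emit false 0) p W' 0 o) := by
  induction h generalizing s W with
  | zero =>
    refine ⟨Function.update W 0 (s.out (W 0)), fun j hj => ?_, fun j hj => ?_, ?_⟩
    · rw [Nat.le_zero.1 hj, Function.update_self]; exact hQ 0 s le_rfl hs
    · rw [Function.update_of_ne (by omega)]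
    · refine reach_step_stay (e := none) hp hh
        (q' := if s.res.isSome then .load s.res else .emit false 0) (m := .stay)
        (c := s.out (W 0)) ?_ ?_
      · rw [delta, hW 0]; simp
      · simpa [moveHead] using reach_refl (Nat.zero_le S)
  | succ h ih =>
    have hne : ∀ j, j ≤ h → Function.update W (h + 1) (s.out (W (h + 1))) j = W j :=
      fun j hj => Function.update_of_ne (by omega) _ _
    obtain ⟨W', h1, h2, h3⟩ := ih (by omega)
      (W := Function.update W (h + 1) (s.out (W (h + 1)))) (s := s.next (W (h + 1)))
      (fun j => by
        by_cases hj : j = h + 1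
        · subst hj; rw [Function.update_self]; exact hW (h + 1)
        · rw [Function.update_of_ne hj]; exact hW j)
      (fun j s hj hPs => by rw [hne _ hj]; exact hP j s (by omega) hPs)
      (fun j s hj hPs => by rw [hne _ hj]; exact hQ j s (by omega) hPs)
      (hP h s le_rfl hs)
    refine ⟨W', fun j hj => ?_, fun j hj => ?_, ?_⟩
    · rcases Nat.lt_or_ge h j with hj' | hj'
      · obtain rfl : j = h + 1 := by omega
        rw [h2 _ hj', Function.update_self]; exact hQ _ s le_rfl hs
      · exact h1 j hj'
    · rw [h2 j (by omega), Function.update_of_ne (by omega)]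
    · refine reach_step_stay (e := none) hp hh (q' := .pick (s.next (W (h + 1)))) (m := .left)
        (c := s.out (W (h + 1))) ?_ ?_
      · rw [delta, hW]; simp
      · rw [show (s.next (W (h + 1))).res = s.res from rfl] at h3
        simpa [moveHead] using h3

lemma succ_div_mod_of_eq {q b : ℕ} (hb : 0 < b) (h : q % b + 1 = b) :
    (q + 1) / b = q / b + 1 ∧ (q + 1) % b = 0 := by
  have := Nat.mod_add_div q b
  have e : q + 1 = b * (q / b + 1) := by rw [mul_add, mul_one]; omega
  rw [e]
  exact ⟨Nat.mul_div_cancel_left _ hb, Nat.mul_mod_right _ _⟩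

lemma succ_div_mod_of_ne {q b : ℕ} (hb : 0 < b) (h : q % b + 1 ≠ b) :
    (q + 1) / b = q / b ∧ (q + 1) % b = q % b + 1 := by
  have h1 := Nat.mod_add_div q b
  have h2 := Nat.mod_lt q hb
  have e : q + 1 = (q % b + 1) + b * (q / b) := by omega
  constructor
  · conv_lhs => rw [e]
    rw [Nat.add_mul_div_left _ _ hb, Nat.div_eq_of_lt (by omega), zero_add]
  · conv_lhs => rw [e]
    rw [Nat.add_mul_mod_self_left, Nat.mod_eq_of_lt (by omega)]

lemma blockBits_pos (w : Fin 4) : 0 < blockBits w := by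
  unfold blockBits; split_ifs <;> norm_num

lemma blockBits_le (w : Fin 4) : blockBits w ≤ 6 := by
  unfold blockBits; split_ifs <;> norm_num

lemma outBits_pos (w : Bool) : 0 < outBits w := by
  unfold outBits; split_ifs <;> norm_num

lemma outBits_le (w : Bool) : outBits w ≤ 6 := by
  unfold outBits; split_ifs <;> norm_num

lemma ofNat_six_add_one {i : ℕ} (hi : i < 5) :
    (Fin.ofNat 6 i + 1 : Fin 6) = Fin.ofNat 6 (i + 1) := by
  interval_cases i <;> rfl

/-- Reading one input number into the work tape. -/
lemma reach_read {w : Fin 4} {k : ℕ} (W : ℕ → ℕ → Cell)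
    (hW : ∀ q < k.size, W (q + 1) = Function.update (W q) (q / blockBits w)
      (put w (q % blockBits w) (k.testBit q) (W q (q / blockBits w))))
    (hx : ∀ q < k.size, x[p + q]? = some (.bit (k.testBit q)))
    (hsep : x[p + k.size]? = some .sep) (hS : k.size / blockBits w ≤ S) :
    Reach x S (k.size + 1) (conf (.read w 0) p (W 0) 0 o)
      (conf (.back w) (p + k.size + 1) (W k.size) (k.size / blockBits w) o) := by
  have hb := blockBits_pos w
  have hb6 := blockBits_le w
  suffices h : ∀ q ≤ k.size, Reach x S q (conf (.read w 0) p (W 0) 0 o)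
      (conf (.read w (Fin.ofNat 6 (q % blockBits w))) (p + q) (W q) (q / blockBits w) o) by
    refine (h _ le_rfl).trans ?_
    refine reach_step (e := none) hS (q' := .back w) (im := .right) (m := .stay)
      (c := W k.size (k.size / blockBits w)) ?_ ?_
    · rw [hsep]; rfl
    · have := (List.getElem?_eq_some_iff.1 hsep).1
      rw [Function.update_eq_self, show moveHead (p + k.size) .right = p + k.size + 1 from rfl,
        min_eq_left (by omega)]
      simpa [moveHead] using reach_refl (T := 0) hS
  intro q
  induction q with
  | zero => intro _; simpa using reach_refl (Nat.zero_le S)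
  | succ q ih =>
    intro hq
    refine (ih (by omega)).trans ?_
    have hlt := (List.getElem?_eq_some_iff.1 (hx q hq)).1
    have hm := Nat.mod_lt q hb
    have hS' : q / blockBits w ≤ S := (Nat.div_le_div_right (by omega)).trans hS
    have hi : ((Fin.ofNat 6 (q % blockBits w) : Fin 6) : ℕ) = q % blockBits w := by
      rw [Fin.val_ofNat, Nat.mod_eq_of_lt (by omega)]
    by_cases hl : q % blockBits w + 1 = blockBits w
    · obtain ⟨e1, e2⟩ := succ_div_mod_of_eq hb hl
      rw [e1, e2]
      refine reach_step (e := none) hS' (q' := .read w 0) (im := .right) (m := .right)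
        (c := put w (q % blockBits w) (k.testBit q) (W q (q / blockBits w))) ?_ ?_
      · rw [hx q hq, delta, hi, if_pos hl]
      · rw [← hW q hq, show moveHead (p + q) .right = p + q + 1 from rfl, min_eq_left (by omega)]
        have : q / blockBits w + 1 ≤ S := e1 ▸ (Nat.div_le_div_right hq).trans hS
        simpa [moveHead, add_assoc] using reach_refl (T := 0) this
    · obtain ⟨e1, e2⟩ := succ_div_mod_of_ne hb hl
      rw [e1, e2]
      refine reach_step (e := none) hS' (q' := .read w (Fin.ofNat 6 (q % blockBits w + 1)))
        (im := .right) (m := .stay)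
        (c := put w (q % blockBits w) (k.testBit q) (W q (q / blockBits w))) ?_ ?_
      · rw [hx q hq, delta, hi, if_neg hl, ofNat_six_add_one (by omega)]
      · rw [← hW q hq, show moveHead (p + q) .right = p + q + 1 from rfl, min_eq_left (by omega)]
        simpa [moveHead, add_assoc] using reach_refl (T := 0) hS'

lemma bits_eq_map (k : ℕ) : k.bits = (List.range k.size).map k.testBit := by
  apply List.ext_getElem
  · simp [Nat.size_eq_bits_len]
  · intro i h1 h2
    simp only [List.getElem_map, List.getElem_range]
    rw [Nat.testBit_eq_inth, List.getI_eq_getElem _ h1]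

/-- Writing one output number. -/
lemma reach_emit {w : Bool} {k : ℕ} {W : ℕ → Cell} (hp : p ≤ x.length)
    (hsig : ∀ j i, i < outBits w →
      significant w (W j) i = decide (k / 2 ^ (outBits w * j + i) ≠ 0))
    (hbit : ∀ j i, i < outBits w → (outDigit w (W j)).testBit i = k.testBit (outBits w * j + i))
    (hS : k.size / outBits w ≤ S) :
    Reach x S (k.size + 1) (conf (.emit w 0) p W 0 o)
      (conf (if w then .halt else .rewind) p W (k.size / outBits w)
        (o ++ (k.bits.map IOSym.bit ++ [IOSym.sep]))) := by
  have hb := outBits_pos w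
  have hb6 := outBits_le w
  suffices h : ∀ q ≤ k.size, Reach x S q (conf (.emit w 0) p W 0 o)
      (conf (.emit w (Fin.ofNat 6 (q % outBits w))) p W (q / outBits w)
        (o ++ (((List.range q).map k.testBit).map IOSym.bit))) by
    refine (h _ le_rfl).trans ?_
    have hi : ((Fin.ofNat 6 (k.size % outBits w) : Fin 6) : ℕ) = k.size % outBits w := by
      rw [Fin.val_ofNat, Nat.mod_eq_of_lt ((Nat.mod_lt _ hb).trans_le hb6)]
    refine reach_step_stay (e := some .sep) hp hS (q' := if w then .halt else .rewind) (m := .stay)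
      (c := W (k.size / outBits w)) ?_ ?_
    · rw [delta, hi, hsig _ _ (Nat.mod_lt _ hb), Nat.div_add_mod,
        Nat.div_eq_of_lt (Nat.lt_size_self k)]
      simp
    · rw [Function.update_eq_self, ← bits_eq_map]
      simpa [moveHead] using reach_refl (T := 0) hS
  intro q
  induction q with
  | zero => intro _; simpa using reach_refl (Nat.zero_le S)
  | succ q ih =>
    intro hq
    refine (ih (by omega)).trans ?_
    have hm := Nat.mod_lt q hb
    have hS' : q / outBits w ≤ S := (Nat.div_le_div_right (by omega)).trans hS
    have hi : ((Fin.ofNat 6 (q % outBits w) : Fin 6) : ℕ) = q % outBits w := by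
      rw [Fin.val_ofNat, Nat.mod_eq_of_lt (by omega)]
    have hne : k / 2 ^ q ≠ 0 := by
      have h1 : 2 ^ q ≤ k := Nat.lt_size.1 hq
      exact (Nat.div_pos h1 (by positivity)).ne'
    have hs : significant w (W (q / outBits w)) (q % outBits w) = true := by
      rw [hsig _ _ hm, Nat.div_add_mod]; simpa using hne
    have ht : (outDigit w (W (q / outBits w))).testBit (q % outBits w) = k.testBit q := by
      rw [hbit _ _ hm, Nat.div_add_mod]
    have ho : o ++ (((List.range (q + 1)).map k.testBit).map IOSym.bit) =
        (o ++ (((List.range q).map k.testBit).map IOSym.bit)) ++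
          (some (IOSym.bit (k.testBit q))).toList := by
      simp [List.range_succ]
    rw [ho]
    by_cases hl : q % outBits w + 1 = outBits w
    · obtain ⟨e1, e2⟩ := succ_div_mod_of_eq hb hl
      rw [e1, e2]
      refine reach_step_stay (e := some (.bit (k.testBit q))) hp hS' (q' := .emit w 0)
        (m := .right) (c := W (q / outBits w)) ?_ ?_
      · rw [delta, hi, if_pos hs, if_pos hl, ht]
      · rw [Function.update_eq_self]
        have : q / outBits w + 1 ≤ S := e1 ▸ (Nat.div_le_div_right hq).trans hS
        exact reach_refl (T := 0) this
    · obtain ⟨e1, e2⟩ := succ_div_mod_of_ne hb hl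
      rw [e1, e2]
      refine reach_step_stay (e := some (.bit (k.testBit q))) hp hS'
        (q' := .emit w (Fin.ofNat 6 (q % outBits w + 1))) (m := .stay)
        (c := W (q / outBits w)) ?_ ?_
      · rw [delta, hi, if_pos hs, if_neg hl, ht, ofNat_six_add_one (by omega)]
      · rw [Function.update_eq_self]
        exact reach_refl (T := 0) hS'

end Reach

end WalkMachine

namespace WalkMachine

open OfflineTM

/-! ### The arithmetic of one sweep -/

lemma mod_pow_div_mod {B A K i : ℕ} (hB : 0 < B) (hi : i < K) :
    A % B ^ K / B ^ i % B = A / B ^ i % B := by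
  rw [← ofDigitFun_digits]
  exact ofDigitFun_digit hB (fun _ _ => Nat.mod_lt _ hB) hi

/-- The number with the first `K` bits of `2 q + b`, complemented if `σ` is set. -/
def maskedShift (K : ℕ) (σ b : Bool) (q : ℕ) : ℕ :=
  ofDigitFun 2 (fun i => (xor ((2 * q + b.toNat).testBit i) σ).toNat) K

lemma maskedShift_digit {K i : ℕ} (σ b : Bool) (q : ℕ) (hi : i < K) :
    maskedShift K σ b q / 2 ^ i % 2 = (xor ((2 * q + b.toNat).testBit i) σ).toNat :=
  ofDigitFun_digit (by norm_num) (fun _ _ => Bool.toNat_lt _) hi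

/-- A number and its bitwise complement add up to `2 ^ K - 1`. -/
lemma ofDigitFun_not_add (t K : ℕ) :
    ofDigitFun 2 (fun i => (!(t.testBit i)).toNat) K + t % 2 ^ K + 1 = 2 ^ K := by
  induction K with
  | zero => simp [ofDigitFun, Nat.mod_one]
  | succ K ih =>
    rw [ofDigitFun_succ, Nat.mod_pow_succ, ← Nat.toNat_testBit, pow_succ]
    cases t.testBit K <;> simp <;> omega

/-- Two's complement: subtraction is addition of the complement with initial carry 1. Both signs
therefore need only one rightward pass with a one-bit carry. -/
lemma addShift_eq (K : ℕ) (σ b : Bool) (p q : ℕ) :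
    addShift K σ b p q = (p + maskedShift K σ b q + σ.toNat) % 2 ^ K := by
  unfold addShift maskedShift
  cases σ
  · simp only [Bool.false_eq_true, if_false, Bool.xor_false, Nat.toNat_testBit, ofDigitFun_digits,
      Bool.toNat_false, add_zero, Nat.add_mod_mod]
  · have := ofDigitFun_not_add (2 * q + b.toNat) K
    simp only [if_true, Bool.xor_true, Bool.toNat_true]
    rw [add_assoc]
    congr 2
    omega

/-- The coordinate that a shear changes. -/
def movedPart (K : ℕ) (s : Bool) (X : ℕ) : ℕ := if s then oddPart K X else evenPart K X

/-- The coordinate that a shear keeps. -/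
def keptPart (K : ℕ) (s : Bool) (X : ℕ) : ℕ := if s then evenPart K X else oddPart K X

lemma movedPart_digit {K i : ℕ} (s : Bool) (X : ℕ) (hi : i < K) :
    movedPart K s X / 2 ^ i % 2 = if s then X / 4 ^ i % 4 / 2 else X / 4 ^ i % 4 % 2 := by
  cases s <;> simp [movedPart, evenPart_digit hi, oddPart_digit hi]

lemma keptPart_digit {K i : ℕ} (s : Bool) (X : ℕ) (hi : i < K) :
    keptPart K s X / 2 ^ i % 2 = if s then X / 4 ^ i % 4 % 2 else X / 4 ^ i % 4 / 2 := by
  cases s <;> simp [keptPart, evenPart_digit hi, oddPart_digit hi]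

lemma shear_digit {K i : ℕ} (s σ b : Bool) (X : ℕ) (hi : i < K) :
    shear K s σ b X / 4 ^ i % 4 =
      if s then keptPart K s X / 2 ^ i % 2 +
        2 * (addShift K σ b (movedPart K s X) (keptPart K s X) / 2 ^ i % 2)
      else addShift K σ b (movedPart K s X) (keptPart K s X) / 2 ^ i % 2 +
        2 * (keptPart K s X / 2 ^ i % 2) := by
  cases s <;> simp [shear, keptPart, movedPart, interleave_digit hi]

/-- The point over the vertex `v` on the sheet of a label. -/
def point (n v : ℕ) (l : Label) : ℕ := v + l.2.1 * n

/-- The sheared point. -/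
def shearedPoint (n v : ℕ) (l : Label) : ℕ :=
  shear (quadDigits n) l.2.2.1 l.2.2.2.1 l.2.2.2.2 (point n v l)

/-- The control of the sweep to the right holds the carries and borrows at position `i`. -/
structure ScanInv (n v : ℕ) (l : Label) (i : ℕ) (s : Scan) : Prop where
  lab : s.lab = l
  cj : point n v l / 4 ^ i = v / 4 ^ i + l.2.1 * (n / 4 ^ i) + s.cj
  zb : s.zb = (2 * keptPart (quadDigits n) l.2.2.1 (point n v l) + l.2.2.2.2.toNat).testBit i
  cz : (movedPart (quadDigits n) l.2.2.1 (point n v l) + maskedShift (quadDigits n) l.2.2.2.1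
      l.2.2.2.2 (keptPart (quadDigits n) l.2.2.1 (point n v l)) + l.2.2.2.1.toNat) / 2 ^ i =
    movedPart (quadDigits n) l.2.2.1 (point n v l) / 2 ^ i + maskedShift (quadDigits n) l.2.2.2.1
      l.2.2.2.2 (keptPart (quadDigits n) l.2.2.1 (point n v l)) / 2 ^ i + s.cz.toNat
  bw : ∀ j : Fin 4, ((shearedPoint n v l : ℤ) - j * n) / 4 ^ i =
    ((shearedPoint n v l / 4 ^ i : ℕ) : ℤ) - j * ((n / 4 ^ i : ℕ) : ℤ) - (s.bw j : ℕ)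

/-- The initial carry is the sign `σ`, for two's complement. The initial delayed bit is `b`, the
lowest bit of `2 q + b`; the delay by one place performs the doubling. -/
lemma scanInv_zero (n v : ℕ) (d res : Option (Fin 64)) :
    ScanInv n v (labelEquiv (d.getD 0)) 0 (Scan.initial d res) := by
  constructor <;> simp [Scan.initial, point]
  rw [Bool.eq_iff_iff]
  cases (labelEquiv (d.getD 0)).2.2.2.2 <;> simp

/-! ### The carries and borrows across one cell. -/

section Step

variable {n v : ℕ} {l : Label} {i : ℕ} {s : Scan} {c : Cell}

/-- The sum is at most `3 + 3 · 3 + 3 = 15`, so the carry stays below 4. -/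
lemma ScanInv.total_eq (h : ScanInv n v l i s) (hn : (c.nd : ℕ) = n / 4 ^ i % 4)
    (hv : (c.vd : ℕ) = v / 4 ^ i % 4) :
    s.total c % 4 = point n v l / 4 ^ i % 4 ∧ s.total c / 4 < 4 ∧
      point n v l / 4 ^ (i + 1) =
        v / 4 ^ (i + 1) + l.2.1 * (n / 4 ^ (i + 1)) + s.total c / 4 := by
  have h1 := h.cj
  have h2 := s.cj.2
  rw [Scan.total, h.lab, hn, hv, pow_succ, ← Nat.div_div_eq_div_mul, ← Nat.div_div_eq_div_mul,
    ← Nat.div_div_eq_div_mul, h1]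
  generalize v / 4 ^ i = V
  generalize n / 4 ^ i = N
  have h3 := l.2.1.2
  generalize (l.2.1 : ℕ) = j at *
  generalize (s.cj : ℕ) = e at *
  interval_cases j <;> omega

lemma ScanInv.bitSum_eq (h : ScanInv n v l i s) (hi : i < quadDigits n)
    (hn : (c.nd : ℕ) = n / 4 ^ i % 4) (hv : (c.vd : ℕ) = v / 4 ^ i % 4) :
    s.qBit c = keptPart (quadDigits n) l.2.2.1 (point n v l) / 2 ^ i % 2 ∧
    s.bitSum c = movedPart (quadDigits n) l.2.2.1 (point n v l) / 2 ^ i % 2 +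
      maskedShift (quadDigits n) l.2.2.2.1 l.2.2.2.2
        (keptPart (quadDigits n) l.2.2.1 (point n v l)) / 2 ^ i % 2 + s.cz.toNat := by
  have ht := (h.total_eq hn hv).1
  constructor
  · rw [keptPart_digit _ _ hi, Scan.qBit, ht, h.lab]
  · rw [movedPart_digit _ _ hi, maskedShift_digit _ _ _ hi, Scan.bitSum, Scan.pBit, ht, h.zb, h.lab]

lemma ScanInv.newDigit_eq (h : ScanInv n v l i s) (hi : i < quadDigits n)
    (hn : (c.nd : ℕ) = n / 4 ^ i % 4) (hv : (c.vd : ℕ) = v / 4 ^ i % 4) :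
    s.newDigit c = shearedPoint n v l / 4 ^ i % 4 := by
  obtain ⟨hq, hb⟩ := h.bitSum_eq hi hn hv
  have hs : addShift (quadDigits n) l.2.2.2.1 l.2.2.2.2
      (movedPart (quadDigits n) l.2.2.1 (point n v l))
      (keptPart (quadDigits n) l.2.2.1 (point n v l)) / 2 ^ i % 2 = s.bitSum c % 2 := by
    -- Reduction modulo `2 ^ K` does not affect the digits below place `K`.
    rw [addShift_eq, mod_pow_div_mod (by norm_num) hi, h.cz, hb]
    omega
  rw [shearedPoint, shear_digit _ _ _ _ hi, hs, ← hq, Scan.newDigit, h.lab]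

/-- At most `3 · 3 + 3 = 12` is subtracted in one place. The offset `12 = 4 · 3` keeps the
difference a natural number without changing its residue modulo 4, and it is undone in the borrow `3
- diff / 4`. Floor division of integers covers candidates that turn out negative. -/
lemma ScanInv.diff_eq (h : ScanInv n v l i s) (hi : i < quadDigits n)
    (hn : (c.nd : ℕ) = n / 4 ^ i % 4) (hv : (c.vd : ℕ) = v / 4 ^ i % 4) (j : Fin 4) :
    ((s.diff c j % 4 : ℕ) : ℤ) = ((shearedPoint n v l : ℤ) - j * n) / 4 ^ i % 4 ∧
    ((shearedPoint n v l : ℤ) - j * n) / 4 ^ (i + 1) =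
      ((shearedPoint n v l / 4 ^ (i + 1) : ℕ) : ℤ) - j * ((n / 4 ^ (i + 1) : ℕ) : ℤ) -
        (3 - s.diff c j / 4 : ℕ) := by
  have h1 := h.bw j
  have h2 := (s.bw j).2
  have h3 := j.2
  rw [Scan.diff, h.newDigit_eq hi hn hv, hn, pow_succ, pow_succ,
    ← Int.ediv_ediv_of_nonneg (by positivity), ← Nat.div_div_eq_div_mul,
    ← Nat.div_div_eq_div_mul, h1]
  generalize shearedPoint n v l / 4 ^ i = V
  generalize n / 4 ^ i = N
  generalize (s.bw j : ℕ) = e at *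
  generalize (j : ℕ) = j at *
  interval_cases j <;> omega

lemma ScanInv.next (h : ScanInv n v l i s) (hi : i < quadDigits n) (hc : c.inN = true)
    (hn : (c.nd : ℕ) = n / 4 ^ i % 4) (hv : (c.vd : ℕ) = v / 4 ^ i % 4) :
    ScanInv n v l (i + 1) (s.next c) := by
  obtain ⟨-, ht, hT⟩ := h.total_eq hn hv
  obtain ⟨hq, hb⟩ := h.bitSum_eq hi hn hv
  rw [Scan.next, if_pos hc]
  constructor
  · exact h.lab
  · simp only [Fin.val_ofNat]
    rw [Nat.mod_eq_of_lt ht, hT]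
  · simp only [hq]
    rw [Nat.testBit_succ, Nat.testBit_eq_decide_div_mod_eq]
    congr 4
    cases l.2.2.2.2 with
    | false => simp
    | true => simp; omega
  · have h1 := h.cz
    rw [pow_succ, ← Nat.div_div_eq_div_mul, ← Nat.div_div_eq_div_mul, ← Nat.div_div_eq_div_mul, h1,
      hb]
    have : s.cz.toNat < 2 := Bool.toNat_lt _
    generalize movedPart (quadDigits n) l.2.2.1 (point n v l) / 2 ^ i = P
    generalize maskedShift (quadDigits n) l.2.2.2.1 l.2.2.2.2
      (keptPart (quadDigits n) l.2.2.1 (point n v l)) / 2 ^ i = Z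
    by_cases hd : (P % 2 + Z % 2 + s.cz.toNat) / 2 = 1
    · simp only [hd, decide_true, Bool.toNat_true]; omega
    · simp only [hd, decide_false, Bool.toNat_false]; omega
  · intro j
    rw [(h.diff_eq hi hn hv j).2]
    simp only [Fin.val_ofNat]
    rw [Nat.mod_eq_of_lt (show 3 - s.diff c j / 4 < 4 by omega)]

/-- Past the digits of `n` the control keeps its carries and borrows up to the right end; only the
shift of the labels goes on. -/
lemma ScanInv.next_of_not (h : ScanInv n v l i s) (hc : c.inN = false) :
    ScanInv n v l i (s.next c) := by
  rw [Scan.next, if_neg (by simp [hc])]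
  exact ⟨h.lab, h.cj, h.zb, h.cz, h.bw⟩

end Step

/-! ### The decision at the right end of the tape. -/

section Turn

variable {n v : ℕ} {l : Label} {s : Scan}

/-- No digits of `n` or `v` are left at place `K`, so the carry is the whole part of the point
beyond `4 ^ K`. -/
lemma ScanInv.cj_eq_zero_iff (h : ScanInv n v l (quadDigits n) s) (hv : v < n) :
    s.cj = 0 ↔ point n v l < 4 ^ quadDigits n := by
  have hn := lt_four_pow_quadDigits n
  have h1 := h.cj
  rw [Nat.div_eq_of_lt hn, Nat.div_eq_of_lt (hv.trans hn)] at h1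
  rw [← Nat.div_eq_zero_iff_lt (by positivity), h1]
  simp only [mul_zero, zero_add, Fin.val_eq_zero_iff]

/-- At place `K` the quotients of `n` and of the sheared point vanish, so the floor quotient of the
candidate is minus the borrow; it is nonnegative exactly when the candidate is. -/
lemma ScanInv.bw_eq_zero_iff (h : ScanInv n v l (quadDigits n) s) (j : Fin 4) :
    s.bw j = 0 ↔ j * n ≤ shearedPoint n v l := by
  have h1 := h.bw j
  rw [Nat.div_eq_of_lt (lt_four_pow_quadDigits n), Nat.div_eq_of_lt
    (show shearedPoint n v l < 4 ^ quadDigits n from shear_lt _ _ _ _ _)] at h1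
  have h2 := Int.ediv_nonneg_iff_of_pos (a := (shearedPoint n v l : ℤ) - j * n)
    (b := 4 ^ quadDigits n) (by positivity)
  rw [h1] at h2
  rw [Fin.ext_iff, Fin.val_zero]
  constructor
  · intro h0
    rw [h0] at h2
    have := h2.1 (by simp)
    zify; omega
  · intro h0
    zify at h0
    have := h2.2 (by omega)
    simp at this
    omega

/-- Since the sheared point is less than `4 n`, the quotient by `n` is the largest `j ≤ 3` for which
subtracting `j n` leaves no borrow. -/
lemma ScanInv.sheet_eq (h : ScanInv n v l (quadDigits n) s) (hn : 0 < n) :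
    (s.sheet : ℕ) = shearedPoint n v l / n := by
  have h3 := h.bw_eq_zero_iff 3
  have h2 := h.bw_eq_zero_iff 2
  have h1 := h.bw_eq_zero_iff 1
  have hX : shearedPoint n v l < 4 * n :=
    (shear_lt _ _ _ _ _).trans_le (four_pow_quadDigits_le hn)
  rw [show ((3 : Fin 4) : ℕ) = 3 from rfl] at h3
  rw [show ((2 : Fin 4) : ℕ) = 2 from rfl] at h2
  rw [show ((1 : Fin 4) : ℕ) = 1 from rfl] at h1
  rw [Scan.sheet]
  symm
  split_ifs with c3 c2 c1
  · rw [Nat.div_eq_iff hn]; have := h3.1 c3; simp; omega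
  · rw [Nat.div_eq_iff hn]; have := h2.1 c2; have := mt h3.2 c3; simp; omega
  · rw [Nat.div_eq_iff hn]; have := h1.1 c1; have := mt h2.2 c2; simp; omega
  · rw [Nat.div_eq_iff hn]; have := mt h1.2 c1; simp; omega

/-- What the control does at the right end of the tape. -/
lemma ScanInv.turn_eq {d : Option (Fin 64)}
    (h : ScanInv n v (labelEquiv (d.getD 0)) (quadDigits n) s) (ha : s.act = d.isSome)
    (hv : v < n) :
    ∃ sel, s.turn = ⟨sel, d.map fun d => (hop n v d).2, none, false, false⟩ ∧
      ((sel = none ∧ (d.map fun d => (hop n v d).1).getD v = v) ∨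
        ∃ j : Fin 4, sel = some j ∧
          (((d.map fun d => (hop n v d).1).getD v : ℕ) : ℤ) =
            (shearedPoint n v (labelEquiv (d.getD 0)) : ℤ) - j * n) := by
  cases d with
  | none =>
    refine ⟨none, ?_, Or.inl ⟨rfl, rfl⟩⟩
    rw [Scan.turn, ha]; simp
  | some d =>
    simp only [Option.getD_some, Option.map_some] at h ⊢
    have hcj := h.cj_eq_zero_iff hv
    have hsh := h.sheet_eq (by omega)
    have hmod := Nat.mod_add_div (shearedPoint n v (labelEquiv d)) n
    rw [Scan.turn, ha, if_pos (by simp), h.lab]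
    simp only [hcj]
    have hj : Fin.ofNat 4 (shearedPoint n v (labelEquiv d) / n) = s.sheet := by
      rw [← hsh]; simp
    unfold hop
    obtain ⟨⟨go, j, sh, σ, b⟩, e⟩ : ∃ l, labelEquiv d = l := ⟨_, rfl⟩
    rw [e] at hj hsh hmod ⊢
    change Fin.ofNat 4 (shear (quadDigits n) sh σ b (v + j * n) / n) = _ at hj
    simp only [point]
    by_cases hg : go = true ∧ v + j * n < 4 ^ quadDigits n
    · obtain ⟨rfl, hg⟩ := hg
      refine ⟨some s.sheet, ?_, Or.inr ⟨s.sheet, rfl, ?_⟩⟩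
      · simp only [hg, and_self, if_true, hj]
      · simp only [hg, and_self, if_true]
        rw [hsh]
        change ((shearedPoint n v (true, j, sh, σ, b) % n : ℕ) : ℤ) = _
        zify at hmod
        push_cast
        linarith
    · refine ⟨none, ?_, Or.inl ⟨rfl, ?_⟩⟩
      · simp only [hg, if_false]
        rw [← e, Equiv.symm_apply_apply]
      · simp only [hg, if_false]

end Turn

/-! ### One step of the walk -/

/-- The work tape shows `n`, the vertex `v`, the labels `l` ahead and the labels `B` behind. -/
structure Shows (n L v : ℕ) (l B : List (Fin 64)) (W : ℕ → Cell) : Prop where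
  first : ∀ j, (W j).first = decide (j = 0)
  used : ∀ j, (W j).used = decide (j < L)
  inN : ∀ j, (W j).inN = decide (j < quadDigits n)
  nd : ∀ j, ((W j).nd : ℕ) = n / 4 ^ j % 4
  vd : ∀ j, ((W j).vd : ℕ) = v / 4 ^ j % 4
  ad : ∀ j, (W j).ad = l[j]?
  bd : ∀ j, (W j).bd = B[j]?
  unmarked : ∀ j, L ≤ j → (W j).sv = false ∧ (W j).sb = false

/-- The marks for nonzero digits further right are correct. -/
def Marked (v : ℕ) (B : List (Fin 64)) (W : ℕ → Cell) : Prop :=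
  ∀ j, (W j).sv = decide (v / 4 ^ (j + 1) ≠ 0) ∧
    (W j).sb = decide (ofDigitList B / 64 ^ (j + 1) ≠ 0)

/-- The recursion by which the sweep to the left updates the marks for nonzero digits further right.
-/
lemma decide_div_pow_succ_ne_zero (b m j : ℕ) :
    decide (m / b ^ j ≠ 0) =
      (decide (m / b ^ (j + 1) ≠ 0) || decide (m / b ^ j % b ≠ 0)) := by
  rw [pow_succ, ← Nat.div_div_eq_div_mul, Bool.eq_iff_iff]
  generalize m / b ^ j = y
  have := Nat.mod_add_div y b
  simp only [ne_eq, decide_eq_true_eq, Bool.or_eq_true]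
  constructor
  · intro h
    by_contra hc
    push Not at hc
    rw [hc.1, hc.2] at this
    omega
  · rintro (h | h) rfl <;> simp at h

/-- The sweep to the right pushes the reversed label `res` of the previous round and computes the
candidates; the sweep to the left selects one and pops the label just used. A round with no label
left changes neither vertex nor labels ahead, but still performs the pending push. -/
lemma reach_round {x : List IOSym} {S p n L v : ℕ} {l B : List (Fin 64)} {o : List IOSym}
    {res : Option (Fin 64)} {W : ℕ → Cell} (hp : p ≤ x.length) (hLS : L ≤ S) (hv : v < n)
    (hK : quadDigits n ≤ L) (hl : l.length ≤ L) (hB : (res.toList ++ B).length ≤ L)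
    (hres : res = none → B = []) (hL : 0 < L) (hW : Shows n L v l B W) :
    ∃ W', Shows n L ((l.head?.map fun d => (hop n v d).1).getD v) l.tail (res.toList ++ B) W' ∧
      Marked ((l.head?.map fun d => (hop n v d).1).getD v) (res.toList ++ B) W' ∧
      Reach x S (2 * L + 2) (conf (.load res) p W 0 o)
        (conf (if (l.head?.map fun d => (hop n v d).2).isSome then
          .load (l.head?.map fun d => (hop n v d).2) else .emit false 0) p W' 0 o) := by
  set K := quadDigits n with hKdef
  set lab := labelEquiv (l.head?.getD 0) with hlab
  set v' := (l.head?.map fun d => (hop n v d).1).getD v with hv'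
  set B' := res.toList ++ B with hB'
  have hv'n : v' < n := by
    rw [hv']
    cases l.head? with
    | none => exact hv
    | some d => exact hop_lt hv d
  have hB0 : B'[0]? = res := by
    cases res with
    | none => simp [hB', hres rfl]
    | some d => simp [hB']
  -- The sweep always shifts the labels behind by one cell. When there is nothing to push they are
  -- empty, so the shift is harmless.
  have hBs : ∀ j, B'[j + 1]? = B[j]? := by
    intro j
    cases res with
    | none => simp [hB', hres rfl]
    | some d => simp [hB']
  obtain ⟨s', W₁, ⟨hs1, hs2, -⟩, hQ, hQ', hreach⟩ := reach_scan (x := x) (o := o) hp hLS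
    (fun j s => ScanInv n v lab (min j K) s ∧ s.act = l.head?.isSome ∧ s.bp = B'[j]?)
    (fun j c => c.first = decide (j = 0) ∧ c.used = decide (j < L) ∧ c.inN = decide (j < K) ∧
      (c.nd : ℕ) = n / 4 ^ j % 4 ∧ (c.vd : ℕ) = v / 4 ^ j % 4 ∧ c.ad = l[j]? ∧ c.bd = B'[j]? ∧
      (j < K → ∀ i : Fin 4,
        ((c.cand i : ℕ) : ℤ) = ((shearedPoint n v lab : ℤ) - i * n) / 4 ^ j % 4))
    hW.used
    (by
      rintro j hj s ⟨h1, h2, h3⟩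
      refine ⟨?_, ?_, ?_⟩
      · by_cases hjK : j < K
        · rw [min_eq_left hjK.le] at h1
          rw [min_eq_left (by omega)]
          exact h1.next hjK (by rw [hW.inN]; simpa using hjK) (hW.nd j) (hW.vd j)
        · rw [min_eq_right (by omega)] at h1 ⊢
          exact h1.next_of_not (by rw [hW.inN]; simpa using hjK)
      · rw [← h2, Scan.next]; split_ifs <;> rfl
      · rw [hBs, ← hW.bd j, Scan.next]; split_ifs <;> rfl)
    (by
      rintro j hj s ⟨h1, h2, h3⟩
      refine ⟨hW.first j, hW.used j, hW.inN j, hW.nd j, hW.vd j, hW.ad j, h3, fun hjK i => ?_⟩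
      rw [min_eq_left hjK.le] at h1
      rw [← (h1.diff_eq hjK (hW.nd j) (hW.vd j) i).1]
      simp [Scan.out])
    (s := Scan.initial (W 0).ad res)
    ⟨by
      rw [hW.ad, hlab, Nat.zero_min, ← List.head?_eq_getElem?]
      exact scanInv_zero n v _ _,
    by rw [Scan.initial, hW.ad, List.head?_eq_getElem?],
    by rw [hB0]; rfl⟩
  rw [min_eq_right hK] at hs1
  obtain ⟨sel, hturn, hsel⟩ := hs1.turn_eq hs2 hv
  have hnone : ∀ j, L ≤ j → v / 4 ^ j = 0 ∧ v' / 4 ^ j = 0 := by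
    intro j hj
    have h1 : n < 4 ^ j :=
      (lt_four_pow_quadDigits n).trans_le (Nat.pow_le_pow_right (by norm_num) (by omega))
    exact ⟨Nat.div_eq_of_lt (by omega), Nat.div_eq_of_lt (by omega)⟩
  have hBnum : ∀ j, L ≤ j → ofDigitList B' / 64 ^ j = 0 := fun j hj =>
    Nat.div_eq_of_lt ((ofDigitList_lt B').trans_le
      (Nat.pow_le_pow_right (by norm_num) (hB.trans hj)))
  have hdig : ∀ j < L, ∀ s : Pick, s.sel = sel → ((s.digit (W₁ j) : Fin 4) : ℕ) = v' / 4 ^ j % 4 := by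
    intro j hj s hss
    obtain ⟨-, -, q3, -, q5, -, -, q8⟩ := hQ j hj
    rw [Pick.digit, hss, q3]
    by_cases hjK : j < K
    · simp only [hjK, decide_true, if_true]
      rcases hsel with ⟨rfl, e⟩ | ⟨i, rfl, e⟩
      · simp only [Option.map_none, Option.getD_none]
        rw [q5, ← hv'] at *; rw [e]
      · simp only [Option.map_some, Option.getD_some]
        have := q8 hjK i
        rw [← e, ← hv'] at this
        exact_mod_cast this
    · simp only [hjK, decide_false, Bool.false_eq_true, if_false]
      have h1 : n < 4 ^ j :=
        (lt_four_pow_quadDigits n).trans_le (Nat.pow_le_pow_right (by norm_num) (by omega))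
      rw [q5, Nat.div_eq_of_lt (by omega), Nat.div_eq_of_lt (show v' < 4 ^ j by omega)]
  obtain ⟨W₂, hR, hR', hreach'⟩ := reach_pick (x := x) (o := o) (h := L - 1) (S := S) hp (by omega)
    (fun j s => s.sel = sel ∧ s.ap = l[j + 1]? ∧ s.gv = decide (v' / 4 ^ (j + 1) ≠ 0) ∧
      s.gb = decide (ofDigitList B' / 64 ^ (j + 1) ≠ 0))
    (fun j c => c.first = decide (j = 0) ∧ c.used = decide (j < L) ∧ c.inN = decide (j < K) ∧
      (c.nd : ℕ) = n / 4 ^ j % 4 ∧ (c.vd : ℕ) = v' / 4 ^ j % 4 ∧ c.ad = l[j + 1]? ∧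
      c.bd = B'[j]? ∧ c.sv = decide (v' / 4 ^ (j + 1) ≠ 0) ∧
      c.sb = decide (ofDigitList B' / 64 ^ (j + 1) ≠ 0))
    (W := W₁)
    (by
      intro j
      by_cases hj : j < L
      · exact (hQ j hj).1
      · rw [hQ' j (by omega)]; exact hW.first j)
    (by
      rintro j s hj ⟨h1, h2, h3, h4⟩
      obtain ⟨-, -, -, -, -, q6, q7, -⟩ := hQ (j + 1) (by omega)
      refine ⟨h1, q6, ?_, ?_⟩
      · rw [decide_div_pow_succ_ne_zero, ← h3, ← hdig (j + 1) (by omega) s h1]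
        simp only [Pick.next, ne_eq, Fin.val_eq_zero_iff]
      · rw [decide_div_pow_succ_ne_zero, ← h4, ofDigitList_div_mod, ← q7]
        simp only [Pick.next, ne_eq, Fin.val_eq_zero_iff])
    (by
      rintro j s hj ⟨h1, h2, h3, h4⟩
      obtain ⟨q1, q2, q3, q4, -, -, q7, -⟩ := hQ j (by omega)
      exact ⟨q1, q2, q3, q4, hdig j (by omega) s h1, h2, q7, h3, h4⟩)
    (s := s'.turn)
    (by
      rw [hturn, Nat.sub_add_cancel hL, (hnone L le_rfl).2, hBnum L le_rfl,
        List.getElem?_eq_none hl]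
      simp)
  have hlate : ∀ j, L ≤ j → W₂ j = W j := fun j hj => by rw [hR' j (by omega), hQ' j hj]
  refine ⟨W₂, ?_, ?_, ?_⟩
  · constructor
    · intro j
      by_cases hj : j < L
      · exact (hR j (by omega)).1
      · rw [hlate j (by omega)]; exact hW.first j
    · intro j
      by_cases hj : j < L
      · exact (hR j (by omega)).2.1
      · rw [hlate j (by omega)]; exact hW.used j
    · intro j
      by_cases hj : j < L
      · exact (hR j (by omega)).2.2.1
      · rw [hlate j (by omega)]; exact hW.inN j
    · intro j
      by_cases hj : j < L
      · exact (hR j (by omega)).2.2.2.1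
      · rw [hlate j (by omega)]; exact hW.nd j
    · intro j
      by_cases hj : j < L
      · exact (hR j (by omega)).2.2.2.2.1
      · rw [hlate j (by omega), hW.vd, (hnone j (by omega)).1, (hnone j (by omega)).2]
    · intro j
      by_cases hj : j < L
      · rw [(hR j (by omega)).2.2.2.2.2.1]; simp
      · rw [hlate j (by omega), hW.ad, List.getElem?_eq_none (by omega),
          List.getElem?_eq_none (by simp; omega)]
    · intro j
      by_cases hj : j < L
      · exact (hR j (by omega)).2.2.2.2.2.2.1
      · rw [hlate j (by omega), hW.bd, ← hBs, List.getElem?_eq_none (by omega),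
          List.getElem?_eq_none (by omega)]
    · intro j hj
      rw [hlate j hj]; exact hW.unmarked j hj
  · intro j
    by_cases hj : j < L
    · exact (hR j (by omega)).2.2.2.2.2.2.2
    · rw [hlate j (by omega), (hnone (j + 1) (by omega)).2, hBnum (j + 1) (by omega)]
      simpa using hW.unmarked j (by omega)
  · rw [hturn] at hreach'
    have hlast : Reach x S (L + 1) (conf (.scan s') p W₁ L o)
        (conf (if (l.head?.map fun d => (hop n v d).2).isSome then
          .load (l.head?.map fun d => (hop n v d).2) else .emit false 0) p W₂ 0 o) := by
      rw [Nat.sub_add_cancel hL] at hreach'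
      refine reach_step_stay (e := none) hp hLS (q' := .pick s'.turn) (m := .left) (c := W₁ L) ?_ ?_
      · rw [delta, hQ' L le_rfl, hW.used]; simp
      · rw [Function.update_eq_self, hturn]
        simpa [moveHead] using hreach'
    have hfirst : Reach x S 1 (conf (.load res) p W 0 o)
        (conf (.scan (Scan.initial (W 0).ad res)) p W 0 o) := by
      refine reach_step_stay (e := none) hp (Nat.zero_le S)
        (q' := .scan (Scan.initial (W 0).ad res)) (m := .stay) (c := W 0) rfl ?_
      rw [Function.update_eq_self]
      simpa [moveHead] using reach_refl (T := 0) (Nat.zero_le S)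
    -- One step to load, `L` to the right, one to turn and `L` to the left.
    exact ((hfirst.trans hreach).trans hlast).mono (by omega)

/-- All steps of the walk. -/
lemma reach_walk {x : List IOSym} {S p n L v : ℕ} {l B : List (Fin 64)} {o : List IOSym}
    {res : Option (Fin 64)} {W : ℕ → Cell} (hp : p ≤ x.length) (hLS : L ≤ S) (hv : v < n)
    (hK : quadDigits n ≤ L) (hl : l.length + (res.toList ++ B).length ≤ L)
    (hres : res = none → B = []) (hL : 0 < L) (hW : Shows n L v l B W) :
    ∃ W', Shows n L (l.foldl (walkStep n) (v, res.toList ++ B)).1 []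
        (l.foldl (walkStep n) (v, res.toList ++ B)).2 W' ∧
      Marked (l.foldl (walkStep n) (v, res.toList ++ B)).1
        (l.foldl (walkStep n) (v, res.toList ++ B)).2 W' ∧
      Reach x S ((l.length + 1) * (2 * L + 2)) (conf (.load res) p W 0 o)
        (conf (.emit false 0) p W' 0 o) := by
  induction l generalizing v B res W with
  | nil =>
    -- The extra round without a label stores the last pending reversed label and sets the marks
    -- needed for output.
    obtain ⟨W', h1, h2, h3⟩ := reach_round (o := o) hp hLS hv hK (by simp)
      (by omega) hres hL hW
    refine ⟨W', h1, h2, ?_⟩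
    simpa using h3
  | cons d l ih =>
    have hlen : (d :: l).length = l.length + 1 := rfl
    obtain ⟨W₁, h1, -, h3⟩ := reach_round (o := o) hp hLS hv hK (by omega) (by omega) hres hL hW
    obtain ⟨W', h4, h5, h6⟩ := ih (v := (hop n v d).1) (B := res.toList ++ B)
      (res := some (hop n v d).2) (hop_lt hv d)
      (by simp only [Option.toList_some, List.length_append, List.length_singleton] at hl ⊢; omega)
      (by simp) h1
    refine ⟨W', h4, h5, ?_⟩
    have h3' : Reach x S (2 * L + 2) (conf (.load res) p W 0 o)
        (conf (.load (some (hop n v d).2)) p W₁ 0 o) := by simpa using h3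
    refine (h3'.trans h6).mono ?_
    rw [hlen]
    ring_nf
    omega

end WalkMachine

namespace WalkMachine

open OfflineTM

/-! ### The work tape while the input is read -/

/-- Bit `b j + i` of a number is bit `i` of its base `2 ^ b` digit in place `j`; other digits do not
see it. -/
lemma mod_pow_succ_div_self {b B j i q x : ℕ} (hB : B = 2 ^ b) (hq : q = b * j + i) :
    x % 2 ^ (q + 1) / B ^ j = x % 2 ^ q / B ^ j + (x.testBit q).toNat * 2 ^ i := by
  have e : 2 ^ q = B ^ j * 2 ^ i := by rw [hB, ← pow_mul, ← pow_add, hq]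
  rw [Nat.mod_pow_succ, Nat.toNat_testBit]
  conv_lhs => rw [show 2 ^ q * (x / 2 ^ q % 2) = B ^ j * (x / 2 ^ q % 2 * 2 ^ i) by rw [e]; ring]
  exact Nat.add_mul_div_left _ _ (by rw [hB]; positivity)

lemma mod_pow_succ_div_of_ne {b B j q x : ℕ} (hB : B = 2 ^ b) (hb : 0 < b) (hj : j ≠ q / b) :
    x % 2 ^ (q + 1) / B ^ j % B = x % 2 ^ q / B ^ j % B := by
  have hB0 : 0 < B := by rw [hB]; positivity
  have hq := Nat.div_add_mod q b
  rcases Nat.lt_or_gt_of_ne hj with h | h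
  · have e : 2 ^ q = B ^ j * (B * 2 ^ (q - b * (j + 1))) := by
      rw [hB, ← mul_assoc, ← pow_succ, ← pow_mul, ← pow_add]
      congr 1
      have : b * (j + 1) ≤ b * (q / b) := Nat.mul_le_mul_left _ h
      omega
    rw [Nat.mod_pow_succ]
    conv_lhs => rw [show 2 ^ q * (x / 2 ^ q % 2) =
      B ^ j * (B * (2 ^ (q - b * (j + 1)) * (x / 2 ^ q % 2))) by rw [e]; ring]
    rw [Nat.add_mul_div_left _ _ (pow_pos hB0 j), Nat.add_mul_mod_self_left]
  · have h1 : 2 ^ (q + 1) ≤ B ^ j := by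
      rw [hB, ← pow_mul]
      refine Nat.pow_le_pow_right (by norm_num) ?_
      have h2 : b * (q / b + 1) ≤ b * j := Nat.mul_le_mul_left _ h
      have h3 := Nat.mod_lt q hb
      rw [mul_add, mul_one] at h2
      omega
    rw [Nat.div_eq_of_lt ((Nat.mod_lt _ (by positivity)).trans_le h1), Nat.div_eq_of_lt
      ((Nat.mod_lt _ (by positivity)).trans_le ((Nat.pow_le_pow_right (by norm_num)
        (Nat.le_succ q)).trans h1))]

lemma ofNat_mod_pow_succ {b B q x : ℕ} [NeZero B] (hB : B = 2 ^ b) :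
    Fin.ofNat B (x % 2 ^ (q + 1) / B ^ (q / b)) =
      Fin.ofNat B ((Fin.ofNat B (x % 2 ^ q / B ^ (q / b)) : ℕ) +
        (x.testBit q).toNat * 2 ^ (q % b)) := by
  rw [mod_pow_succ_div_self hB (Nat.div_add_mod q b).symm]
  ext
  simp

lemma ofNat_mod_pow_succ_of_ne {b B j q x : ℕ} [NeZero B] (hB : B = 2 ^ b) (hb : 0 < b)
    (hj : j ≠ q / b) :
    Fin.ofNat B (x % 2 ^ (q + 1) / B ^ j) = Fin.ofNat B (x % 2 ^ q / B ^ j) := by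
  ext
  simp only [Fin.val_ofNat]
  exact mod_pow_succ_div_of_ne hB hb hj

/-- The work tape after `q` bits of `n`. -/
def tapeN (n q j : ℕ) : Cell :=
  { first := decide (j = 0)
    used := decide (j = 0 ∨ 2 * j < q)
    inN := decide (2 * j < q)
    nd := Fin.ofNat 4 (n % 2 ^ q / 4 ^ j)
    vd := 0
    cand := fun _ => 0
    ad := none
    bd := none
    sv := false
    sb := false }

/-- The work tape after `q` bits of the degree. -/
def tapeC (n q j : ℕ) : Cell :=
  { tapeN n n.size j with
    used := decide (j = 0 ∨ 2 * j < n.size ∨ 6 * (j + 1) ≤ q)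
    ad := if 6 * (j + 1) ≤ q then some 0 else none }

/-- The work tape after `q` bits of `v`. -/
def tapeV (n c v q j : ℕ) : Cell :=
  { tapeC n c.size j with vd := Fin.ofNat 4 (v % 2 ^ q / 4 ^ j) }

/-- The work tape after `q` bits of `a`. -/
def tapeA (n c v a q j : ℕ) : Cell :=
  { tapeV n c v v.size j with
    ad := if 6 * (j + 1) ≤ c.size then some (Fin.ofNat 64 (a % 2 ^ q / 64 ^ j)) else none }

lemma tapeN_succ (n q : ℕ) : tapeN n (q + 1) = Function.update (tapeN n q) (q / blockBits 0)
    (put 0 (q % blockBits 0) (n.testBit q) (tapeN n q (q / blockBits 0))) := by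
  have hb : blockBits 0 = 2 := rfl
  rw [hb]
  funext j
  by_cases hj : j = q / 2
  · rw [hj, Function.update_self, put, if_pos rfl]
    ext : 1
    case nd => exact ofNat_mod_pow_succ (B := 4) (b := 2) rfl
    all_goals simp [tapeN]
    all_goals omega
  · rw [Function.update_of_ne hj]
    ext : 1
    case nd => exact ofNat_mod_pow_succ_of_ne (B := 4) (b := 2) rfl (by norm_num) hj
    all_goals simp only [tapeN, show 2 * j < q + 1 ↔ 2 * j < q by omega]

lemma tapeC_zero (n : ℕ) : tapeC n 0 = tapeN n n.size := by
  funext j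
  ext : 1 <;> simp [tapeC, tapeN]

/-- Only the length of the degree matters: `64 ^ t` has `6 t + 1` bits, so exactly `t` blocks of six
bits are completed, and each reserves a cell for one label. -/
lemma tapeC_succ (n q : ℕ) (b : Bool) : tapeC n (q + 1) = Function.update (tapeC n q)
    (q / blockBits 1) (put 1 (q % blockBits 1) b (tapeC n q (q / blockBits 1))) := by
  have hb : blockBits 1 = 6 := rfl
  rw [hb]
  funext j
  by_cases hj : j = q / 6
  · rw [hj, Function.update_self, put, if_neg (by decide), if_pos rfl]
    by_cases h5 : q % 6 = 5
    · rw [if_pos h5]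
      have h6 : 6 * (q / 6 + 1) ≤ q + 1 := by omega
      ext : 1 <;> simp [tapeC, tapeN, h6]
    · rw [if_neg h5]
      have h6 : ¬6 * (q / 6 + 1) ≤ q + 1 := by omega
      have h7 : ¬6 * (q / 6 + 1) ≤ q := by omega
      ext : 1 <;> simp [tapeC, tapeN, h6, h7]
  · rw [Function.update_of_ne hj]
    have : 6 * (j + 1) ≤ q + 1 ↔ 6 * (j + 1) ≤ q := by omega
    ext : 1 <;> simp [tapeC, tapeN, this]

lemma tapeV_zero (n c v : ℕ) : tapeV n c v 0 = tapeC n c.size := by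
  funext j
  ext : 1 <;> simp [tapeV, tapeC, tapeN, Nat.mod_one]

lemma tapeV_succ (n c v q : ℕ) : tapeV n c v (q + 1) = Function.update (tapeV n c v q)
    (q / blockBits 2) (put 2 (q % blockBits 2) (v.testBit q) (tapeV n c v q (q / blockBits 2))) := by
  have hb : blockBits 2 = 2 := rfl
  rw [hb]
  funext j
  by_cases hj : j = q / 2
  · rw [hj, Function.update_self, put, if_neg (by decide), if_neg (by decide), if_pos rfl]
    ext : 1
    case vd => exact ofNat_mod_pow_succ (B := 4) (b := 2) rfl
    all_goals rfl
  · rw [Function.update_of_ne hj]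
    ext : 1
    case vd => exact ofNat_mod_pow_succ_of_ne (B := 4) (b := 2) rfl (by norm_num) hj
    all_goals rfl

lemma tapeA_zero (n c v a : ℕ) : tapeA n c v a 0 = tapeV n c v v.size := by
  funext j
  ext : 1 <;> simp [tapeA, tapeV, tapeC, tapeN, Nat.mod_one]

lemma tapeA_succ (n c v a q : ℕ) :
    tapeA n c v a (q + 1) = Function.update (tapeA n c v a q) (q / blockBits 3)
      (put 3 (q % blockBits 3) (a.testBit q) (tapeA n c v a q (q / blockBits 3))) := by
  have hb : blockBits 3 = 6 := rfl
  rw [hb]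
  funext j
  by_cases hj : j = q / 6
  · rw [hj, Function.update_self, put, if_neg (by decide), if_neg (by decide), if_neg (by decide)]
    ext : 1
    case ad =>
      simp only [tapeA]
      split_ifs
      · exact congrArg some (ofNat_mod_pow_succ (B := 64) (b := 6) rfl)
      · rfl
    all_goals rfl
  · rw [Function.update_of_ne hj]
    ext : 1
    case ad =>
      simp only [tapeA]
      rw [ofNat_mod_pow_succ_of_ne (B := 64) (b := 6) rfl (by norm_num) hj]
    all_goals rfl

lemma size_sixtyfour_pow (t : ℕ) : (64 ^ t).size = 6 * t + 1 := by
  rw [show (64 : ℕ) = 2 ^ 6 by norm_num, ← pow_mul, Nat.size_pow]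

/-- After the input has been read, the work tape shows the four numbers. -/
lemma shows_tapeA {n v a t : ℕ} (hn : 0 < n) :
    Shows n (max (quadDigits n) t) v (digitList t a) [] (tapeA n (64 ^ t) v a a.size) := by
  have hs := Nat.size_pos.2 hn
  have hd : ∀ m B i : ℕ, m % 2 ^ m.size / B ^ i = m / B ^ i := fun m B i => by
    rw [Nat.mod_eq_of_lt (Nat.lt_size_self m)]
  constructor
  · intro j; rfl
  · intro j
    simp only [tapeA, tapeV, tapeC, size_sixtyfour_pow]
    congr 1
    rw [quadDigits, lt_max_iff]
    apply propext
    omega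
  · intro j
    simp only [tapeA, tapeV, tapeC, tapeN]
    congr 1
    rw [quadDigits]
    apply propext
    omega
  · intro j
    simp only [tapeA, tapeV, tapeC, tapeN, hd, Fin.val_ofNat]
  · intro j
    simp only [tapeA, tapeV, hd, Fin.val_ofNat]
  · intro j
    simp only [tapeA, size_sixtyfour_pow, hd]
    by_cases hj : j < t
    · rw [if_pos (by omega), List.getElem?_eq_getElem (by simpa using hj)]
      simp [digitList]
    · rw [if_neg (by omega), List.getElem?_eq_none (by simp; omega)]
  · intro j; rfl
  · intro j _; exact ⟨rfl, rfl⟩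

/-! ### The run of the machine -/

/-- Reading one input number and returning to the left end of the work tape. -/
lemma reach_number {x pre post : List IOSym} {S : ℕ} {o : List IOSym} {w : Fin 4} {k : ℕ}
    (W : ℕ → ℕ → Cell) (hx : x = pre ++ ((k.bits.map IOSym.bit ++ [IOSym.sep]) ++ post))
    (hW : ∀ q, W (q + 1) = Function.update (W q) (q / blockBits w)
      (put w (q % blockBits w) (k.testBit q) (W q (q / blockBits w))))
    (hfirst : ∀ j, (W k.size j).first = decide (j = 0)) (hS : k.size / blockBits w ≤ S) :
    Reach x S (2 * k.size + 2) (conf (.read w 0) pre.length (W 0) 0 o)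
      (conf (if w = 3 then .load none else .read (w + 1) 0)
        (pre ++ (k.bits.map IOSym.bit ++ [IOSym.sep])).length (W k.size) 0 o) := by
  have hlen : (k.bits.map IOSym.bit).length = k.size := by simp [Nat.size_eq_bits_len]
  have h1 : ∀ q < k.size, x[pre.length + q]? = some (.bit (k.testBit q)) := by
    intro q hq
    rw [hx, List.getElem?_append_right (by omega), Nat.add_sub_cancel_left, List.append_assoc,
      List.getElem?_append_left (by omega), bits_eq_map, List.getElem?_map, List.getElem?_map,
      List.getElem?_range hq]
    rfl
  have h2 : x[pre.length + k.size]? = some .sep := by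
    rw [hx, List.getElem?_append_right (by omega), Nat.add_sub_cancel_left, List.append_assoc,
      List.getElem?_append_right (by omega), hlen, Nat.sub_self]
    rfl
  have hpl : (pre ++ (k.bits.map IOSym.bit ++ [IOSym.sep])).length = pre.length + k.size + 1 := by
    simp only [List.length_append, hlen, List.length_singleton]; omega
  rw [hpl]
  have hp : pre.length + k.size + 1 ≤ x.length := (List.getElem?_eq_some_iff.1 h2).1
  refine ((reach_read (o := o) W (fun q _ => hW q) h1 h2 hS).trans
    (reach_back hp hS hfirst)).mono ?_
  have := Nat.div_le_self k.size (blockBits w)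
  omega

/-- This is the stopping test for output. A binary word carries no superfluous zeros, and one cell
with its mark decides whether any nonzero bit remains. -/
lemma significant_digit {b B m j i : ℕ} (hB : B = 2 ^ b) (hi : i < b) :
    (decide (m / B ^ (j + 1) ≠ 0) || decide (m / B ^ j % B / 2 ^ i ≠ 0)) =
      decide (m / 2 ^ (b * j + i) ≠ 0) := by
  have hlt : 2 ^ i < B := by rw [hB]; exact Nat.pow_lt_pow_right (by norm_num) hi
  rw [pow_succ, ← Nat.div_div_eq_div_mul, pow_add, pow_mul, ← hB, ← Nat.div_div_eq_div_mul,
    Bool.eq_iff_iff]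
  generalize m / B ^ j = y
  have hy := Nat.mod_add_div y B
  have hpos : 0 < 2 ^ i := by positivity
  simp only [Bool.or_eq_true, decide_eq_true_eq, ne_eq, Nat.div_eq_zero_iff_lt hpos,
    Nat.div_eq_zero_iff_lt (hpos.trans hlt), not_lt]
  constructor
  · rintro (h | h)
    · exact hlt.le.trans h
    · exact h.trans (Nat.mod_le _ _)
  · intro h
    rcases Nat.lt_or_ge y B with hlt' | hge
    · right; rwa [Nat.mod_eq_of_lt hlt']
    · exact Or.inl hge

lemma testBit_digit {b B m j i : ℕ} (hB : B = 2 ^ b) (hi : i < b) :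
    (m / B ^ j % B).testBit i = m.testBit (b * j + i) := by
  rw [hB, ← pow_mul, Nat.testBit_mod_two_pow, Nat.testBit_div_two_pow]
  simp [hi, add_comm]

/-- Writing the result of the walk. -/
lemma reach_output {x : List IOSym} {S p n L v : ℕ} {B : List (Fin 64)} {W : ℕ → Cell}
    (hp : p ≤ x.length) (hW : Shows n L v [] B W) (hM : Marked v B W)
    (hv : v.size / 2 ≤ S) (hB : (ofDigitList B).size / 6 ≤ S) :
    ∃ C, C.out = encodeNats [v, ofDigitList B] ∧ walkMachine.step x C = none ∧
      Reach x S (2 * v.size + (ofDigitList B).size + 3) (conf (.emit false 0) p W 0 []) C := by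
  have h1 := reach_emit (o := []) (w := false) (k := v) hp (W := W)
    (fun j i hi => by
      simp only [significant, outDigit, Bool.false_eq_true, if_false, (hM j).1, hW.vd]
      exact significant_digit (b := 2) rfl hi)
    (fun j i hi => by
      simp only [outDigit, Bool.false_eq_true, if_false, hW.vd]
      exact testBit_digit (b := 2) rfl hi) hv
  have h2 := reach_rewind (o := [] ++ (v.bits.map IOSym.bit ++ [IOSym.sep])) hp hv hW.first
  have h3 := reach_emit (o := [] ++ (v.bits.map IOSym.bit ++ [IOSym.sep])) (w := true)
    (k := ofDigitList B) hp (W := W)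
    (fun j i hi => by
      simp only [significant, outDigit, if_true, (hM j).2, hW.bd, ← ofDigitList_div_mod]
      exact significant_digit (b := 6) rfl hi)
    (fun j i hi => by
      simp only [outDigit, if_true, hW.bd, ← ofDigitList_div_mod]
      exact testBit_digit (b := 6) rfl hi) hB
  refine ⟨_, ?_, ?_, ((h1.trans h2).trans h3).mono ?_⟩
  · simp [conf, encodeNats]
  · exact step_halt
  · have := Nat.div_le_self v.size (outBits false)
    omega

lemma tapeN_zero (n : ℕ) : Function.update (fun _ => blankCell) 0
    { blankCell with first := true, used := true } = tapeN n 0 := by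
  funext j
  by_cases hj : j = 0
  · subst hj
    rw [Function.update_self]
    ext : 1 <;> simp [tapeN, blankCell, Nat.mod_one]
  · rw [Function.update_of_ne hj]
    ext : 1 <;> simp [tapeN, blankCell, hj, Nat.mod_one]

/-- All four inputs and both outputs have `O(log (n c))` bits, and the tape has `L = max K t` cells
in use. The dominant cost is `t + 1` rounds of `2 L + 2` steps, and the head stays on the cells `0,
…, L`. -/
lemma computesWithin_walk {n v a t : ℕ} (hv : v < n) (ha : a < 64 ^ t) :
    walkMachine.ComputesWithin (encodeNats [n, 64 ^ t, v, a])
      (encodeNats [(walk n v (digitList t a)).1, ofDigitList (walk n v (digitList t a)).2])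
      (20 * (Nat.log 2 (n * 64 ^ t) + 2) ^ 2) (2 * (Nat.log 2 (n * 64 ^ t) + 1)) := by
  set s := Nat.log 2 (n * 64 ^ t) with hs
  set L := max (quadDigits n) t with hL
  set c := 64 ^ t with hc
  have hn : 0 < n := by omega
  have hc0 : 0 < c := by rw [hc]; positivity
  have hlt : n * c < 2 ^ (s + 1) := Nat.lt_pow_succ_log_self (by norm_num) _
  have hns : n.size ≤ s + 1 := Nat.size_le.2 ((Nat.le_mul_of_pos_right n hc0).trans_lt hlt)
  have hcs : c.size ≤ s + 1 := Nat.size_le.2 ((Nat.le_mul_of_pos_left c hn).trans_lt hlt)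
  have hvs : v.size ≤ n.size := Nat.size_le_size hv.le
  have has : a.size ≤ c.size := Nat.size_le_size ha.le
  have hct : c.size = 6 * t + 1 := size_sixtyfour_pow t
  have hK : quadDigits n = (n.size + 1) / 2 := rfl
  have hL0 : 0 < L := by have := Nat.size_pos.2 hn; omega
  have hLs : L ≤ s + 1 := by omega
  set g : ℕ → List IOSym := fun k => k.bits.map IOSym.bit ++ [IOSym.sep] with hg
  obtain ⟨x, hx⟩ : ∃ x, x = encodeNats [n, c, v, a] := ⟨_, rfl⟩
  have hxg : x = g n ++ (g c ++ (g v ++ g a)) := by rw [hx]; simp [encodeNats, hg]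
  have r0 : Reach x L 1 walkMachine.init (conf (.read 0 0) 0 (tapeN n 0) 0 []) := by
    rw [init_eq]
    refine reach_step_stay (e := none) (Nat.zero_le _) (Nat.zero_le _) (q' := .read 0 0)
      (m := .stay) (c := { blankCell with first := true, used := true }) rfl ?_
    rw [tapeN_zero n]
    simpa [moveHead] using reach_refl (T := 0) (Nat.zero_le L)
  have r1 := reach_number (S := L) (o := []) (w := 0) (k := n) (pre := []) (tapeN n)
    (show x = [] ++ (g n ++ (g c ++ (g v ++ g a))) by rw [hxg]; rfl) (tapeN_succ n)
    (fun j => rfl) (by rw [show blockBits 0 = 2 from rfl]; omega)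
  rw [← tapeC_zero] at r1
  have r2 := reach_number (S := L) (o := []) (w := 1) (k := c) (pre := [] ++ g n) (tapeC n)
    (show x = ([] ++ g n) ++ (g c ++ (g v ++ g a)) by rw [hxg]; rfl)
    (fun q => tapeC_succ n q (c.testBit q))
    (fun j => rfl) (by rw [show blockBits 1 = 6 from rfl]; omega)
  rw [← tapeV_zero n c v] at r2
  have r3 := reach_number (S := L) (o := []) (w := 2) (k := v) (pre := ([] ++ g n) ++ g c)
    (tapeV n c v)
    (show x = (([] ++ g n) ++ g c) ++ (g v ++ g a) by rw [hxg]; simp)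
    (tapeV_succ n c v)
    (fun j => rfl) (by rw [show blockBits 2 = 2 from rfl]; omega)
  rw [← tapeA_zero n c v a] at r3
  have r4 := reach_number (S := L) (o := []) (w := 3) (k := a)
    (pre := (([] ++ g n) ++ g c) ++ g v) (post := []) (tapeA n c v a)
    (show x = ((([] ++ g n) ++ g c) ++ g v) ++ (g a ++ []) by rw [hxg]; simp)
    (tapeA_succ n c v a)
    (fun j => rfl) (by rw [show blockBits 3 = 6 from rfl]; omega)
  have hp : (((([] ++ g n) ++ g c) ++ g v) ++ g a).length ≤ x.length := by rw [hxg]; simp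
  obtain ⟨W, hW, hM, r5⟩ := reach_walk (S := L) (o := []) (res := none) hp le_rfl hv
    (le_max_left _ _) (by simp [hL]) (fun _ => rfl) hL0 (shows_tapeA (v := v) (a := a) (t := t) hn)
  have hfold : (digitList t a).foldl (walkStep n) (v, (none : Option (Fin 64)).toList ++ []) =
      walk n v (digitList t a) := rfl
  rw [hfold] at hW hM
  have hws : (walk n v (digitList t a)).1.size ≤ n.size := Nat.size_le_size (walk_lt hv _).le
  have hbs : (ofDigitList (walk n v (digitList t a)).2).size ≤ c.size := by
    refine Nat.size_le_size ?_
    have := ofDigitList_lt (walk n v (digitList t a)).2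
    rw [walk_length, digitList_length] at this
    exact this.le
  obtain ⟨C, hC, hC', r6⟩ := reach_output (S := L) hp hW hM (by omega) (by omega)
  have r := (((((r0.trans r1).trans r2).trans r3).trans r4).trans r5).trans r6
  have hfin := (r.mono (T' := 20 * (s + 2) ^ 2) (by
    rw [digitList_length]
    have h1 : (t + 1) * (2 * L + 2) ≤ (s + 2) * (2 * (s + 2)) :=
      Nat.mul_le_mul (by omega) (by omega)
    nlinarith)).computesWithin hC'
  rw [hC, hx] at hfin
  obtain ⟨τ, h1, h2, h3, h4⟩ := hfin
  refine ⟨τ, h1, h2, h3, h4.trans ?_⟩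
  change 1 * (L + 1) ≤ _
  omega

end WalkMachine

lemma walkFamily_stronglyExplicit : walkFamily.StronglyExplicit := by
  refine ⟨walkMachine, Polynomial.C 20 * (Polynomial.X + Polynomial.C 2) ^ 2, 2,
    fun n c h v a => ?_⟩
  have hc := h.2.choose_spec.2
  have := WalkMachine.computesWithin_walk (n := n) (v := v) (a := a) (t := h.2.choose) v.2
    (lt_of_lt_of_eq a.2 hc)
  rw [← show c = 64 ^ h.2.choose from hc] at this
  simp only [Polynomial.eval_mul, Polynomial.eval_pow, Polynomial.eval_add, Polynomial.eval_X,
    Polynomial.eval_C]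
  exact this


theorem theorem4 :
    ∃ H : GraphFamily, H.StronglyExplicit ∧ H.IsExpander ∧
      ∃ (deg : ℝ → ℕ) (p : Polynomial ℝ), ∀ lambda : ℝ, 0 < lambda → lambda < 1 →
        (deg lambda : ℝ) ≤ p.eval (1 / lambda) ∧
        ∀ n : ℕ, 1 < n →
          ∃ h : (n, deg lambda) ∈ H.index, (H.graph n (deg lambda) h).lam ≤ lambda := by
  obtain ⟨len, p, hp⟩ := exists_degree
  refine ⟨walkFamily, walkFamily_stronglyExplicit, walkFamily_isExpander,
    fun x => 64 ^ (len x + 1), p, fun x h0 h1 => ⟨(hp x h0 h1).2, fun n hn => ?_⟩⟩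
  have h : (n, 64 ^ (len x + 1)) ∈ walkFamily.index := ⟨hn, len x + 1, Nat.succ_pos _, rfl⟩
  refine ⟨h, (walkGraph_lam_le n _ _ h.2.choose_spec.2).trans ?_⟩
  -- The walk length chosen in the family is determined by the degree.
  have e : h.2.choose = len x + 1 :=
    Nat.pow_right_injective (le_refl 2 |>.trans (by norm_num) : 2 ≤ 64)
      h.2.choose_spec.2.symm
  rw [e]
  exact (hp x h0 h1).1
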